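/- **Theorem 4.2 (Local–Global Principle).** Let $A$ be a (not necessarily unital) $C^*$-algebra and let $E$ be a Hilbert $C^*$-module over $A$: a right $A$-module that is complete for the norm $\|x\|=\|\langle x,x\rangle\|^{1/2}$ of an $A$-valued inner product, conjugate linear in the first and $A$-linear in the second variable. *Operators.* All operators $T:\operatorname{dom}(T)\to E$ are linear. $T$ is *densely defined* if $\operatorname{dom}(T)$ is a dense $A$-submodule of $E$. Its adjoint $T^*$ has as domain the set of all $y\in E$ for which there is $z\in E$ with $\langle Tx,y\rangle=\langle x,z\rangle$ for all $x\in\operatorname{dom}(T)$, and $T^*y=z$. $T$ is *semiregular* if $T$ and $T^*$ are densely defined. A closed semiregular operator $T$ is *regular* if $I+T^*T$ has dense range. A densely defined $T$ is *symmetric* if $T\subset T^*$ and *selfadjoint* if $T=T^*$. *Localizations.* A representation $\pi$ of $A$ on a Hilbert space $H_\pi$ is a $*$-homomorphism from $A$ to the bounded operators on $H_\pi$. The interior tensor product $E\hat\otimes_A H_\pi$ is the Hausdorff completion of $E\otimes H_\pi$ for the semi-inner product $\langle x\otimes h,x'\otimes h'\rangle=\langle h,\pi(\langle x,x'\rangle)h'\rangle$.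 For semiregular $T$, the localization $T^\pi$ is the closure of the operator in $E\hat\otimes_A H_\pi$ whose domain is the span of the vectors $x\otimes h$ with $x\in\operatorname{dom}(T)$, $h\in H_\pi$, and which maps $x\otimes h$ to $(Tx)\otimes h$. A state $\omega$ of $A$ is a positive linear functional of norm one. $E^\omega$ is the Hausdorff completion of $E$ for the semi-inner product $\omega(\langle x,y\rangle)$, $\iota_\omega:E\to E^\omega$ is the natural map, and the localization $T^\omega$ is the closure of the operator in $E^\omega$ with domain $\iota_\omega(\operatorname{dom}(T))$ that maps $\iota_\omega(x)$ to $\iota_\omega(Tx)$. 1. For a closed semiregular operator $T$ in $E$ the following statements are equivalent: (1) $T$ is regular. (2) For every representation $(\pi,H_\pi)$ of $A$, $(T^*)^\pi=(T^\pi)^*$. (3) For every state $\omega$ of $A$, $(T^*)^\omega=(T^\omega)^*$. 2. For a closed, densely defined and symmetric operator $T$ in $E$ the following statements are equivalent: (1) $T$ is selfadjoint and regular. (2) For every representation $(\pi,H_\pi)$ of $A$ the localization $T^\pi$ is selfadjoint. (3) For every state $\omega$ of $A$ the localization $T^\omega$ is selfadjoint. -/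

import Mathlib

open MulOpposite UniformSpace
open scoped TensorProduct ComplexOrder InnerProductSpace LinearPMap

/-!
Conventions. A Hilbert module is a *right* module over a not necessarily unital algebra `A`: the
right action `x · a` is `op a • x`, so that right Hilbert `A`-modules are the complete
`CStarModule`s over `Aᵐᵒᵖ`. Inner products are linear in the second variable.
-/

universe u v w

noncomputable section

set_option linter.unusedSectionVars false

namespace HilbertModule


variable (A : Type u) [NonUnitalCStarAlgebra A] [PartialOrder A] [StarOrderedRing A]
variable {E : Type v} [NormedAddCommGroup E] [NormedSpace ℂ E] [SMul Aᵐᵒᵖ E] [CStarModule Aᵐᵒᵖ E]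

/-! ### The inner product with values in `A` -/

/-- The `A`-valued inner product `⟨x, y⟩` of a right Hilbert `A`-module. -/
def ip (x y : E) : A := unop (inner Aᵐᵒᵖ x y)

lemma ip_add_right (x y z : E) : ip A x (y + z) = ip A x y + ip A x z := by simp [ip]

lemma ip_add_left (x y z : E) : ip A (x + y) z = ip A x z + ip A y z := by simp [ip]

lemma ip_smul_right (c : ℂ) (x y : E) : ip A x (c • y) = c • ip A x y := by simp [ip]

lemma ip_smul_left (c : ℂ) (x y : E) : ip A (c • x) y = star c • ip A x y := by simp [ip]

/-- The inner product is `A`-linear in the second variable: `⟨x, y · a⟩ = ⟨x, y⟩ a`. -/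
lemma ip_op_smul_right (a : A) (x y : E) : ip A x (op a • y) = ip A x y * a := by simp [ip]

lemma ip_op_smul_left (a : A) (x y : E) : ip A (op a • x) y = star a * ip A x y := by simp [ip]

lemma star_ip (x y : E) : star (ip A x y) = ip A y x := by
  rw [ip, ip, ← unop_star, CStarModule.star_inner]

lemma ip_self_nonneg (x : E) : 0 ≤ ip A x x :=
  (CStarModule.inner_self_nonneg : (0 : Aᵐᵒᵖ) ≤ inner Aᵐᵒᵖ x x)

lemma ip_self_eq_zero (x : E) : ip A x x = 0 ↔ x = 0 := by
  rw [ip, unop_eq_zero_iff, CStarModule.inner_self]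

lemma norm_sq_eq_norm_ip (x : E) : ‖x‖ ^ 2 = ‖ip A x x‖ :=
  CStarModule.norm_sq_eq Aᵐᵒᵖ

lemma ip_zero_right (x : E) : ip A x 0 = 0 := by simp [ip]

lemma ip_sum_left {ι : Type*} (s : Finset ι) (f : ι → E) (y : E) :
    ip A (∑ i ∈ s, f i) y = ∑ i ∈ s, ip A (f i) y := by
  simp [ip, Finset.unop_sum]

lemma ip_sum_right {ι : Type*} (s : Finset ι) (x : E) (f : ι → E) :
    ip A x (∑ i ∈ s, f i) = ∑ i ∈ s, ip A x (f i) := by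
  simp [ip, Finset.unop_sum]

lemma continuous_ip_left (y : E) : Continuous fun x : E => ip A x y :=
  continuous_unop.comp
    ((CStarModule.continuous_inner (A := Aᵐᵒᵖ) (E := E)).comp (by fun_prop :
      Continuous fun x : E => (x, y)))

lemma continuous_ip_right (x : E) : Continuous fun y : E => ip A x y :=
  continuous_unop.comp
    ((CStarModule.continuous_inner (A := Aᵐᵒᵖ) (E := E)).comp (by fun_prop :
      Continuous fun y : E => (x, y)))

lemma eq_zero_of_dense {S : Set E} (hS : Dense S) {y : E} (h : ∀ x ∈ S, ip A x y = 0) : y = 0 := by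
  have hcl : IsClosed {x : E | ip A x y = 0} :=
    isClosed_eq (continuous_ip_left A y) continuous_const
  have := hcl.closure_subset_iff.2 h
  exact (ip_self_eq_zero A y).1 (this (hS y))

/-! ### Unbounded operators in Hilbert modules -/

/-- The graph of the adjoint: all `(y, z)` with `⟨T x, y⟩ = ⟨x, z⟩` for every `x ∈ dom T`. -/
def adjointGraph (T : E →ₗ.[ℂ] E) : Submodule ℂ (E × E) where
  carrier := {p | ∀ x : T.domain, ip A (T x) p.1 = ip A (x : E) p.2}
  add_mem' hp hq x := by simp [ip_add_right, hp x, hq x]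
  zero_mem' x := by simp [ip_zero_right]
  smul_mem' c p hp x := by simp [ip_smul_right, hp x]

/-- The adjoint `T*` of a densely defined operator in a Hilbert module: `y ∈ dom T*` iff there
is a `z` with `⟨T x, y⟩ = ⟨x, z⟩` for all `x ∈ dom T`, and then `T* y = z`. -/
def adjoint (T : E →ₗ.[ℂ] E) : E →ₗ.[ℂ] E := (adjointGraph A T).toLinearPMap

/-- For densely defined `T` the adjoint has the prescribed graph. -/
lemma graph_adjoint {T : E →ₗ.[ℂ] E} (hT : Dense (T.domain : Set E)) :
    (adjoint A T).graph = adjointGraph A T := by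
  apply Submodule.toLinearPMap_graph_eq
  rintro ⟨y, z⟩ hp (rfl : y = 0)
  refine eq_zero_of_dense A hT fun x hx => ?_
  rw [← hp ⟨x, hx⟩, ip_zero_right]

/-- `T` is *densely defined*: `dom T` is a dense `A`-submodule of `E`. -/
structure IsDenselyDefined (T : E →ₗ.[ℂ] E) : Prop where
  op_smul_mem : ∀ (a : A) (x : E), x ∈ T.domain → op a • x ∈ T.domain
  dense_domain : Dense (T.domain : Set E)

/-- `T` is *semiregular*: `dom T` is a dense `A`-submodule and `T*` is densely defined. -/
structure IsSemiregular (T : E →ₗ.[ℂ] E) : Prop extends IsDenselyDefined A T where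
  dense_adjoint_domain : Dense ((adjoint A T).domain : Set E)

/-- The range of `I + T* T`, where `dom (T* T) = {x ∈ dom T | T x ∈ dom T*}`. -/
def rangeOneAddAdjointMul (T : E →ₗ.[ℂ] E) : Set E :=
  {z | ∃ x y w : E, (x, y) ∈ T.graph ∧ (y, w) ∈ (adjoint A T).graph ∧ z = x + w}

/-- `T` is *regular*: it is closed and semiregular, and `I + T* T` has dense range. -/
structure IsRegularOp (T : E →ₗ.[ℂ] E) : Prop where
  isClosed : T.IsClosed
  isSemiregular : IsSemiregular A T
  dense_range : Dense (rangeOneAddAdjointMul A T)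

/-- `T` is symmetric: `T ⊆ T*`. -/
def IsSymmetric (T : E →ₗ.[ℂ] E) : Prop := T ≤ adjoint A T

/-- `T` is selfadjoint: `T = T*`. -/
def IsSelfadjoint (T : E →ₗ.[ℂ] E) : Prop := T = adjoint A T

variable {A}

/-! ### Localization with respect to a state -/

/-- A state: a positive linear functional of norm one. (Positive functionals are automatically
continuous.) -/
def IsState (ω : A →ₚ[ℂ] ℂ) : Prop :=
  ‖(⟨(ω : A →ₗ[ℂ] ℂ), map_continuous ω⟩ : A →L[ℂ] ℂ)‖ = 1

variable (E) in
/-- `E` with the possibly degenerate scalar product `ω ⟨x, y⟩`. -/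
@[nolint unusedArguments]
def PreState (_ω : A →ₚ[ℂ] ℂ) : Type v := E

instance (ω : A →ₚ[ℂ] ℂ) : AddCommGroup (PreState E ω) := inferInstanceAs (AddCommGroup E)
instance (ω : A →ₚ[ℂ] ℂ) : Module ℂ (PreState E ω) := inferInstanceAs (Module ℂ E)

/-- The identity map `E → PreState E ω`. -/
def toPreState (ω : A →ₚ[ℂ] ℂ) : E ≃ₗ[ℂ] PreState E ω := LinearEquiv.refl ℂ E

/-- The semi-inner product `⟨x, y⟩_ω = ω ⟨x, y⟩`. -/
abbrev preStateCore (ω : A →ₚ[ℂ] ℂ) : PreInnerProductSpace.Core ℂ (PreState E ω) where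
  inner x y := ω (ip A ((toPreState ω).symm x) ((toPreState ω).symm y))
  conj_inner_symm x y := by
    rw [← star_ip A ((toPreState ω).symm y), map_star]; rfl
  re_inner_nonneg x := (RCLike.nonneg_iff.mp (ω.map_nonneg (ip_self_nonneg A _))).1
  add_left x y z := by rw [map_add, ip_add_left, map_add]
  smul_left x y r := by rw [map_smul, ip_smul_left, map_smul]; rfl

instance (ω : A →ₚ[ℂ] ℂ) : SeminormedAddCommGroup (PreState E ω) :=
  InnerProductSpace.Core.toSeminormedAddCommGroup (c := preStateCore ω)

instance (ω : A →ₚ[ℂ] ℂ) : InnerProductSpace ℂ (PreState E ω) :=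
  InnerProductSpace.ofCore (preStateCore ω)

variable (E) in
/-- The Hilbert space `E^ω`: the (Hausdorff) completion of `E` for `ω ⟨x, y⟩`. Vectors of
length zero become zero in it. -/
abbrev StateSpace (ω : A →ₚ[ℂ] ℂ) : Type v := Completion (PreState E ω)

/-- The natural map `ι_ω : E → E^ω`. -/
def stateMap (ω : A →ₚ[ℂ] ℂ) : E →ₗ[ℂ] StateSpace E ω :=
  (Completion.toComplL : PreState E ω →L[ℂ] StateSpace E ω).toLinearMap ∘ₗ
    (toPreState ω).toLinearMap

lemma inner_stateMap (ω : A →ₚ[ℂ] ℂ) (x y : E) :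
    ⟪stateMap ω x, stateMap ω y⟫_ℂ = ω (ip A x y) :=
  Completion.inner_coe (𝕜 := ℂ) (toPreState ω x) (toPreState ω y)

lemma continuous_stateMap (ω : A →ₚ[ℂ] ℂ) :
    Continuous (stateMap ω : E → StateSpace E ω) := by
  obtain ⟨C, hC⟩ := PositiveLinearMap.exists_norm_apply_le ω
  refine AddMonoidHomClass.continuous_of_bound (stateMap ω) (√C) fun x => ?_
  rw [← Real.sqrt_sq (norm_nonneg x), ← Real.sqrt_mul C.coe_nonneg,
    ← Real.sqrt_sq (norm_nonneg (stateMap ω x))]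
  refine Real.sqrt_le_sqrt ?_
  rw [← inner_self_eq_norm_sq (𝕜 := ℂ), inner_stateMap, norm_sq_eq_norm_ip A x]
  exact (RCLike.re_le_norm _).trans (hC _)

lemma dense_range_stateMap (ω : A →ₚ[ℂ] ℂ) :
    Dense (Set.range (stateMap ω : E → StateSpace E ω)) :=
  Completion.denseRange_coe (α := PreState E ω)

/-- The graph of `T₀^ω`: all pairs `(ι_ω x, ι_ω (T x))` with `x ∈ dom T`. -/
def stateGraph (ω : A →ₚ[ℂ] ℂ) (T : E →ₗ.[ℂ] E) :
    Submodule ℂ (StateSpace E ω × StateSpace E ω) :=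
  T.graph.map ((stateMap ω).prodMap (stateMap ω))

/-- The operator `T₀^ω` with domain `ι_ω (dom T)` and `T₀^ω (ι_ω x) = ι_ω (T x)`. -/
def stateLocalization₀ (ω : A →ₚ[ℂ] ℂ) (T : E →ₗ.[ℂ] E) :
    StateSpace E ω →ₗ.[ℂ] StateSpace E ω :=
  (stateGraph ω T).toLinearPMap

/-- The localization `T^ω`: the closure of `T₀^ω`. -/
def stateLocalization (ω : A →ₚ[ℂ] ℂ) (T : E →ₗ.[ℂ] E) :
    StateSpace E ω →ₗ.[ℂ] StateSpace E ω :=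
  (stateLocalization₀ ω T).closure

/-! ### The interior tensor product -/

lemma exists_pos_neg_parts {B : Type*} [NonUnitalCStarAlgebra B] [PartialOrder B]
    [StarOrderedRing B] {M : B} (hM : IsSelfAdjoint M) :
    ∃ P N S : B, 0 ≤ P ∧ star N = N ∧ N = star S * S ∧ M = P - N ∧ N * P = 0 := by
  obtain ⟨S, hS⟩ := CStarAlgebra.nonneg_iff_eq_star_mul_self.1 (CFC.negPart_nonneg M)
  exact ⟨M⁺, M⁻, S, CFC.posPart_nonneg M, (IsSelfAdjoint.of_nonneg (CFC.negPart_nonneg M)).star_eq,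
    hS, (CFC.posPart_sub_negPart M hM).symm, CFC.negPart_mul_posPart M⟩

lemma exists_eq_star_mul_self {B : Type*} [NonUnitalCStarAlgebra B] [PartialOrder B]
    [StarOrderedRing B] {M : B} (hM : 0 ≤ M) : ∃ R : B, M = star R * R :=
  CStarAlgebra.nonneg_iff_eq_star_mul_self.1 hM

/-- The Gram matrix `(⟨x i, x j⟩)` is positive in the algebra of matrices over `A`. -/
lemma exists_gram_eq {n : Type*} [Fintype n] (x : n → E) :
    ∃ R : n → n → A, ∀ i j, ip A (x i) (x j) = ∑ k, star (R k i) * R k j := by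
  classical
  let M : CStarMatrix n n A := CStarMatrix.ofMatrix fun i j => ip A (x i) (x j)
  have hMij : ∀ i j, M i j = ip A (x i) (x j) := fun _ _ => rfl
  have hM : IsSelfAdjoint M := by
    ext i j
    rw [CStarMatrix.star_apply, hMij, hMij, star_ip]
  obtain ⟨P, N, S, hP, hNs, hS, hMPN, hNP⟩ := exists_pos_neg_parts hM
  have hcube : star (S * N) * (S * N) = -(star N * M * N) := by
    have h1 : star (S * N) * (S * N) = N * N * N := by
      rw [star_mul, hNs, mul_assoc, ← mul_assoc (star S), ← hS, mul_assoc]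
    have h2 : N * M = -(N * N) := by
      rw [hMPN, mul_sub, hNP, zero_sub]
    rw [h1, hNs, h2, neg_mul, neg_neg]
  have hentry : ∀ i j, (S * N) i j = 0 := by
    intro i j
    have hle : ∑ k, star ((S * N) k j) * (S * N) k j ≤ 0 := by
      have h1 : (star (S * N) * (S * N)) j j
          = ∑ k, star ((S * N) k j) * (S * N) k j := by
        simp only [CStarMatrix.mul_apply (M := star (S * N)), CStarMatrix.star_apply]
      have h2 : (star N * M * N) j j
          = ip A (∑ k, op (N k j) • x k) (∑ k, op (N k j) • x k) := by
        simp only [CStarMatrix.mul_apply, CStarMatrix.star_apply, ip_sum_left, ip_sum_right,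
          ip_op_smul_left, ip_op_smul_right, Finset.sum_mul, hMij, mul_assoc]
      rw [← h1, hcube, CStarMatrix.neg_apply, h2]
      exact neg_nonpos.2 (ip_self_nonneg A _)
    have hge : ∀ k ∈ Finset.univ, 0 ≤ star ((S * N) k j) * (S * N) k j :=
      fun k _ => star_mul_self_nonneg _
    have h0 := (Finset.sum_eq_zero_iff_of_nonneg hge).1
      (le_antisymm hle (Finset.sum_nonneg hge)) i (Finset.mem_univ i)
    exact CStarRing.star_mul_self_eq_zero_iff _ |>.1 h0
  have hSN : S * N = 0 := by ext i j; exact hentry i j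
  have hNN : N * N = 0 := by
    conv_lhs => enter [1]; rw [hS]
    rw [mul_assoc, hSN, mul_zero]
  have hN0 : N = 0 := CStarRing.star_mul_self_eq_zero_iff _ |>.1 (by rw [hNs, hNN])
  have hpos : 0 ≤ M := by
    rw [hMPN, hN0, sub_zero]
    exact hP
  obtain ⟨R, hR⟩ := exists_eq_star_mul_self hpos
  refine ⟨fun k i => R k i, fun i j => ?_⟩
  rw [← hMij, hR, CStarMatrix.mul_apply]
  simp only [CStarMatrix.star_apply]

variable {H : Type w} [NormedAddCommGroup H] [InnerProductSpace ℂ H] [CompleteSpace H]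

/-- The linear functional `x' ⊗ h' ↦ ⟨h, π ⟨x, x'⟩ h'⟩`. -/
def tensorFunctional (π : A →⋆ₙₐ[ℂ] (H →L[ℂ] H)) (x : E) (h : H) : E ⊗[ℂ] H →ₗ[ℂ] ℂ :=
  TensorProduct.lift <| LinearMap.mk₂ ℂ (fun x' h' => ⟪h, π (ip A x x') h'⟫_ℂ)
    (by simp [ip_add_right])
    (by simp [ip_smul_right])
    (by simp)
    (by simp)

variable (E) in
/-- The sesquilinear form with `⟨x ⊗ h, x' ⊗ h'⟩ = ⟨h, π ⟨x, x'⟩ h'⟩`. -/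
def tensorForm (π : A →⋆ₙₐ[ℂ] (H →L[ℂ] H)) :
    E ⊗[ℂ] H →ₗ⋆[ℂ] E ⊗[ℂ] H →ₗ[ℂ] ℂ :=
  TensorProduct.lift <| LinearMap.mk₂'ₛₗ (starRingEnd ℂ) (starRingEnd ℂ)
    (fun x h => tensorFunctional π x h)
    (fun x y h => TensorProduct.ext' fun x' h' => by
      simp [tensorFunctional, ip_add_left])
    (fun c x h => TensorProduct.ext' fun x' h' => by
      simp [tensorFunctional, ip_smul_left])
    (fun x h k => TensorProduct.ext' fun x' h' => by
      simp [tensorFunctional])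
    (fun c x h => TensorProduct.ext' fun x' h' => by
      simp [tensorFunctional, mul_comm])

lemma tensorForm_tmul (π : A →⋆ₙₐ[ℂ] (H →L[ℂ] H)) (x x' : E) (h h' : H) :
    tensorForm E π (x ⊗ₜ h) (x' ⊗ₜ h') = ⟪h, π (ip A x x') h'⟫_ℂ := by
  simp [tensorForm, tensorFunctional]

lemma inner_rep_star (π : A →⋆ₙₐ[ℂ] (H →L[ℂ] H)) (a : A) (h k : H) :
    ⟪h, π (star a) k⟫_ℂ = ⟪π a h, k⟫_ℂ := by
  rw [map_star, ContinuousLinearMap.star_eq_adjoint, ContinuousLinearMap.adjoint_inner_right]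

lemma conj_tensorForm (π : A →⋆ₙₐ[ℂ] (H →L[ℂ] H)) (s t : E ⊗[ℂ] H) :
    starRingEnd ℂ (tensorForm E π t s) = tensorForm E π s t := by
  induction s with
  | zero => simp
  | add s₁ s₂ h₁ h₂ => simp [h₁, h₂]
  | tmul x h =>
    induction t with
    | zero => simp
    | add t₁ t₂ h₁ h₂ => simp [h₁, h₂]
    | tmul y k =>
      rw [tensorForm_tmul, tensorForm_tmul, inner_conj_symm, ← star_ip, ← inner_rep_star,
        star_star]

lemma re_tensorForm_self_nonneg (π : A →⋆ₙₐ[ℂ] (H →L[ℂ] H)) (t : E ⊗[ℂ] H) :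
    0 ≤ RCLike.re (tensorForm E π t t) := by
  obtain ⟨n, x, h, rfl⟩ := TensorProduct.exists_sum_tmul_eq t
  obtain ⟨R, hR⟩ := exists_gram_eq (A := A) x
  have key : tensorForm E π (∑ i, x i ⊗ₜ h i) (∑ j, x j ⊗ₜ h j)
      = ∑ k, ⟪∑ i, π (R k i) (h i), ∑ j, π (R k j) (h j)⟫_ℂ := by
    simp only [map_sum, LinearMap.sum_apply, tensorForm_tmul, hR, map_mul, inner_sum, sum_inner,
      sum_apply, mul_apply_eq_comp, inner_rep_star]
    simp_rw [fun i => Finset.sum_comm (s := Finset.univ) (t := Finset.univ)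
      (f := fun j k => ⟪π (R k j) (h j), π (R k i) (h i)⟫_ℂ)]
    rw [Finset.sum_comm]
  rw [key, map_sum]
  exact Finset.sum_nonneg fun k _ => inner_self_nonneg

variable (E) in
/-- The tensor product `E ⊗ H` with the semi-inner product given by `π`. -/
@[nolint unusedArguments]
def PreTensor (_π : A →⋆ₙₐ[ℂ] (H →L[ℂ] H)) : Type (max v w) := E ⊗[ℂ] H

instance (π : A →⋆ₙₐ[ℂ] (H →L[ℂ] H)) : AddCommGroup (PreTensor E π) :=
  inferInstanceAs (AddCommGroup (E ⊗[ℂ] H))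
instance (π : A →⋆ₙₐ[ℂ] (H →L[ℂ] H)) : Module ℂ (PreTensor E π) :=
  inferInstanceAs (Module ℂ (E ⊗[ℂ] H))

/-- The identity map `E ⊗ H → PreTensor E π`. -/
def toPreTensor (π : A →⋆ₙₐ[ℂ] (H →L[ℂ] H)) : E ⊗[ℂ] H ≃ₗ[ℂ] PreTensor E π :=
  LinearEquiv.refl ℂ (E ⊗[ℂ] H)

/-- The semi-inner product `⟨x ⊗ h, x' ⊗ h'⟩ = ⟨h, π ⟨x, x'⟩ h'⟩`. -/
abbrev preTensorCore (π : A →⋆ₙₐ[ℂ] (H →L[ℂ] H)) :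
    PreInnerProductSpace.Core ℂ (PreTensor E π) where
  inner s t := tensorForm E π ((toPreTensor π).symm s) ((toPreTensor π).symm t)
  conj_inner_symm s t := conj_tensorForm π _ _
  re_inner_nonneg t := re_tensorForm_self_nonneg π _
  add_left s t r := by simp
  smul_left s t c := by simp

instance (π : A →⋆ₙₐ[ℂ] (H →L[ℂ] H)) : SeminormedAddCommGroup (PreTensor E π) :=
  InnerProductSpace.Core.toSeminormedAddCommGroup (c := preTensorCore π)

instance (π : A →⋆ₙₐ[ℂ] (H →L[ℂ] H)) : InnerProductSpace ℂ (PreTensor E π) :=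
  InnerProductSpace.ofCore (preTensorCore π)

variable (E) in
/-- The interior tensor product of `E` and `H` over `A`: the (Hausdorff) completion of `E ⊗ H`
for the semi-inner product `⟨x ⊗ h, x' ⊗ h'⟩ = ⟨h, π ⟨x, x'⟩ h'⟩`. Vectors of length zero become
zero in it, in particular the differences `(x · a) ⊗ h - x ⊗ π a h`, see
`tensorMap_op_smul_tmul`. -/
abbrev TensorSpace (π : A →⋆ₙₐ[ℂ] (H →L[ℂ] H)) : Type (max v w) := Completion (PreTensor E π)

/-- The natural map from `E ⊗ H` to the interior tensor product. -/
def tensorMap (π : A →⋆ₙₐ[ℂ] (H →L[ℂ] H)) : E ⊗[ℂ] H →ₗ[ℂ] TensorSpace E π :=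
  (Completion.toComplL : PreTensor E π →L[ℂ] TensorSpace E π).toLinearMap ∘ₗ
    (toPreTensor π).toLinearMap

lemma inner_tensorMap (π : A →⋆ₙₐ[ℂ] (H →L[ℂ] H)) (s t : E ⊗[ℂ] H) :
    ⟪tensorMap π s, tensorMap π t⟫_ℂ = tensorForm E π s t :=
  Completion.inner_coe (𝕜 := ℂ) (toPreTensor π s) (toPreTensor π t)

lemma continuous_tensorMap_left (π : A →⋆ₙₐ[ℂ] (H →L[ℂ] H)) (h : H) :
    Continuous fun x : E => tensorMap π (x ⊗ₜ[ℂ] h) := by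
  let f : E →ₗ[ℂ] TensorSpace E π := tensorMap π ∘ₗ (TensorProduct.mk ℂ E H).flip h
  refine AddMonoidHomClass.continuous_of_bound f ‖h‖ fun x => ?_
  refine le_of_sq_le_sq ?_ (by positivity)
  have h1 : ‖f x‖ ^ 2 = RCLike.re ⟪h, π (ip A x x) h⟫_ℂ := by
    rw [← inner_self_eq_norm_sq (𝕜 := ℂ), ← tensorForm_tmul, ← inner_tensorMap]; rfl
  rw [h1, mul_pow, norm_sq_eq_norm_ip A x]
  calc RCLike.re ⟪h, π (ip A x x) h⟫_ℂ ≤ ‖⟪h, π (ip A x x) h⟫_ℂ‖ := RCLike.re_le_norm _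
    _ ≤ ‖h‖ * ‖π (ip A x x) h‖ := norm_inner_le_norm _ _
    _ ≤ ‖h‖ * (‖π (ip A x x)‖ * ‖h‖) := by gcongr; exact ContinuousLinearMap.le_opNorm _ _
    _ ≤ ‖h‖ * (‖ip A x x‖ * ‖h‖) := by gcongr; exact NonUnitalStarAlgHom.norm_apply_le π _
    _ = ‖h‖ ^ 2 * ‖ip A x x‖ := by ring

lemma dense_range_tensorMap (π : A →⋆ₙₐ[ℂ] (H →L[ℂ] H)) :
    Dense (Set.range (tensorMap π : E ⊗[ℂ] H → TensorSpace E π)) :=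
  Completion.denseRange_coe (α := PreTensor E π)

/-- The tensor product is balanced over `A`. -/
lemma tensorMap_op_smul_tmul (π : A →⋆ₙₐ[ℂ] (H →L[ℂ] H)) (a : A) (x : E) (h : H) :
    tensorMap π ((op a • x) ⊗ₜ h) = tensorMap π (x ⊗ₜ (π a h)) := by
  have key : ∀ t : E ⊗[ℂ] H,
      tensorForm E π t ((op a • x) ⊗ₜ h) = tensorForm E π t (x ⊗ₜ (π a h)) := by
    intro t
    induction t with
    | zero => simp
    | add s t hs ht => simp [hs, ht]
    | tmul y k => simp [tensorForm_tmul, ip_op_smul_right]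
  rw [← sub_eq_zero, ← map_sub, ← inner_self_eq_zero (𝕜 := ℂ), inner_tensorMap, map_sub, key,
    sub_self]

/-- The graph of `T₀^π`: the span of the pairs `(x ⊗ h, T x ⊗ h)` with `x ∈ dom T`. -/
def tensorGraph (π : A →⋆ₙₐ[ℂ] (H →L[ℂ] H)) (T : E →ₗ.[ℂ] E) :
    Submodule ℂ (TensorSpace E π × TensorSpace E π) :=
  Submodule.span ℂ
    {p | ∃ (x : T.domain) (h : H), p = (tensorMap π ((x : E) ⊗ₜ h), tensorMap π (T x ⊗ₜ h))}

/-- The operator `T₀^π` with domain `dom T ⊗ H` and `T₀^π (x ⊗ h) = T x ⊗ h`. -/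
def localization₀ (π : A →⋆ₙₐ[ℂ] (H →L[ℂ] H)) (T : E →ₗ.[ℂ] E) :
    TensorSpace E π →ₗ.[ℂ] TensorSpace E π :=
  (tensorGraph π T).toLinearPMap

/-- The localization `T^π`: the closure of `T₀^π`. -/
def localization (π : A →⋆ₙₐ[ℂ] (H →L[ℂ] H)) (T : E →ₗ.[ℂ] E) :
    TensorSpace E π →ₗ.[ℂ] TensorSpace E π :=
  (localization₀ π T).closure

/-! ### Localizations of semiregular operators are well defined -/

lemma toLinearPMap_closable {K : Type*} [NormedAddCommGroup K] [InnerProductSpace ℂ K]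
    (G : Submodule ℂ (K × K)) (F : Set (K × K))
    (hF : Dense (Submodule.span ℂ (Prod.fst '' F) : Set K))
    (hGF : ∀ p ∈ G, ∀ q ∈ F, ⟪q.1, p.2⟫_ℂ = ⟪q.2, p.1⟫_ℂ) :
    G.toLinearPMap.graph = G ∧ G.toLinearPMap.IsClosable ∧
      G.toLinearPMap.closure.graph = G.topologicalClosure := by
  have h1 : ∀ p ∈ G.topologicalClosure, p.1 = 0 → p.2 = 0 := by
    intro p hp hp0
    have h2 : ∀ q ∈ F, ⟪q.1, p.2⟫_ℂ = ⟪q.2, p.1⟫_ℂ := by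
      intro q hq
      have hcl : IsClosed {p : K × K | ⟪q.1, p.2⟫_ℂ = ⟪q.2, p.1⟫_ℂ} :=
        isClosed_eq (by fun_prop) (by fun_prop)
      exact hcl.closure_subset_iff.2 (fun p hp => hGF p hp q hq) hp
    refine hF.eq_zero_of_inner_right ℂ fun v hv => ?_
    induction hv using Submodule.span_induction with
    | mem v hv =>
      obtain ⟨q, hq, rfl⟩ := hv
      rw [h2 q hq, hp0, inner_zero_right]
    | zero => exact inner_zero_left _
    | add u v _ _ hu hv => rw [inner_add_left, hu, hv, add_zero]
    | smul c v _ hv => rw [inner_smul_left, hv, mul_zero]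
  have hG : G.toLinearPMap.graph = G :=
    G.toLinearPMap_graph_eq fun p hp => h1 p (G.le_topologicalClosure hp)
  have hc : G.toLinearPMap.IsClosable :=
    ⟨G.topologicalClosure.toLinearPMap, by
      rw [hG, Submodule.toLinearPMap_graph_eq _ h1]⟩
  exact ⟨hG, hc, by rw [← hc.graph_closure_eq_closure_graph, hG]⟩

/-- For semiregular `T` the operator `T₀^ω` is well defined and closable, so that `T^ω` is the
operator whose graph is the closure of all `(ι_ω x, ι_ω (T x))`. -/
lemma stateLocalization_spec (ω : A →ₚ[ℂ] ℂ) {T : E →ₗ.[ℂ] E} (hT : IsSemiregular A T) :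
    (stateLocalization₀ ω T).graph = stateGraph ω T ∧ (stateLocalization₀ ω T).IsClosable ∧
      (stateLocalization ω T).graph = (stateGraph ω T).topologicalClosure := by
  refine toLinearPMap_closable _
    (stateGraph ω (adjoint A T) : Set (StateSpace E ω × StateSpace E ω)) ?_ ?_
  · have h1 : Dense (stateMap ω '' ((adjoint A T).domain : Set E)) :=
      DenseRange.dense_image (dense_range_stateMap ω) (continuous_stateMap ω) hT.dense_adjoint_domain
    refine h1.mono ?_
    rintro _ ⟨y, hy, rfl⟩
    exact Submodule.subset_span
      ⟨_, ⟨(y, adjoint A T ⟨y, hy⟩), (adjoint A T).mem_graph ⟨y, hy⟩, rfl⟩, rfl⟩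
  · rintro _ ⟨⟨x, x'⟩, hx, rfl⟩ _ ⟨⟨y, y'⟩, hy, rfl⟩
    rw [SetLike.mem_coe, LinearPMap.mem_graph_iff] at hx
    rw [SetLike.mem_coe, graph_adjoint A hT.dense_domain] at hy
    obtain ⟨z, rfl, rfl⟩ := hx
    simp only [LinearMap.prodMap_apply, inner_stateMap]
    rw [← star_ip, hy z, star_ip]

/-- For semiregular `T` the operator `T₀^π` is well defined and closable, so that `T^π` is the
operator whose graph is the closure of the span of all `(x ⊗ h, T x ⊗ h)`. -/
lemma localization_spec (π : A →⋆ₙₐ[ℂ] (H →L[ℂ] H)) {T : E →ₗ.[ℂ] E}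
    (hT : IsSemiregular A T) :
    (localization₀ π T).graph = tensorGraph π T ∧ (localization₀ π T).IsClosable ∧
      (localization π T).graph = (tensorGraph π T).topologicalClosure := by
  refine toLinearPMap_closable _
    {p | ∃ (y : (adjoint A T).domain) (k : H),
      p = (tensorMap π ((y : E) ⊗ₜ k), tensorMap π (adjoint A T y ⊗ₜ k))} ?_ ?_
  · set F := _
    set V : Submodule ℂ (TensorSpace E π) := Submodule.span ℂ (Prod.fst '' F) with hV
    have h1 : ∀ (x : E) (h : H), tensorMap π (x ⊗ₜ h) ∈ V.topologicalClosure := by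
      intro x h
      refine closure_mono ?_ (image_closure_subset_closure_image (continuous_tensorMap_left π h)
        ⟨x, hT.dense_adjoint_domain x, rfl⟩)
      rintro _ ⟨y, hy, rfl⟩
      exact Submodule.subset_span ⟨_, ⟨⟨y, hy⟩, h, rfl⟩, rfl⟩
    have h2 : ∀ t : E ⊗[ℂ] H, tensorMap π t ∈ V.topologicalClosure := by
      intro t
      induction t with
      | zero => simp
      | add s t hs ht => rw [map_add]; exact add_mem hs ht
      | tmul x h => exact h1 x h
    refine dense_iff_closure_eq.2 (Set.eq_univ_of_univ_subset ?_)
    rw [← (dense_range_tensorMap π).closure_eq]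
    exact closure_minimal (by rintro _ ⟨t, rfl⟩; exact h2 t) isClosed_closure
  · rintro p hp _ ⟨y, k, rfl⟩
    induction hp using Submodule.span_induction with
    | mem p hp =>
      obtain ⟨x, h, rfl⟩ := hp
      simp only [inner_tensorMap, tensorForm_tmul]
      have hy := (adjoint A T).mem_graph y
      rw [graph_adjoint A hT.dense_domain] at hy
      rw [← star_ip, hy x, star_ip]
    | zero => simp
    | add u v _ _ hu hv => simp only [Prod.fst_add, Prod.snd_add, inner_add_right, hu, hv]
    | smul c v _ hv => simp only [Prod.smul_fst, Prod.smul_snd, inner_smul_right, hv]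

end HilbertModule

end

open HilbertModule

/-!
The three conditions are one density statement, read in three places. For subspaces `G`, `G'` of
`V × V` let `graphSum G G'` be the sum of `G` and of `G'` rotated by `(x, y) ↦ (-y, x)`. For the
graphs of `T` and of an operator `S ⊆ T*` the two summands are orthogonal.

* In a Hilbert space, the closure of `S` is the adjoint of `T` if and only if `graphSum` of the
  graphs is dense (`adjoint_le_closure_iff_dense`, `eq_adjoint_iff_dense`): this is the
  decomposition of `K ⊕ K` by a closed subspace and its orthogonal complement. So the conditions on
  `T^π` and `T^ω` say that `graphSum` of the localized graphs is dense.
* In a Hilbert module closed subspaces need not be complemented, and complementability of the graph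
  is what regularity means: `T` is regular with `S = T*` if and only if `graphSum` of the graphs of
  `T` and `S` is dense in `E ⊕ E` (`dense_graphSum_of_isRegularOp`,
  `eq_adjoint_and_isRegularOp_of_dense`). The orthogonal sum of two closed graphs is closed
  (`isClosed_graphSum`), hence a dense one is everything.

It remains to carry density around a circle. From `E` to a representation it passes because
`x ↦ x ⊗ h` is continuous (`dense_graphSum_tensorGraph`). From the GNS representation of a state
`ω` to `ω` itself it passes along the isometry `x ⊗ [a] ↦ ι_ω (x · a)`, which has dense range since
`E · A` is dense in `E`, so that no cyclic vector is needed (`dense_graphSum_stateGraph`). From all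
states back to `E` it passes by a Hahn-Banach argument (`dense_of_forall_isState`): if `p` has
positive distance to a subspace `M` of `E ⊕ E`, then the elements of `A` above some
`⟨p - m, p - m⟩` with `m ∈ M` form a convex set that avoids a ball around `0`, and a functional
separating the two is, up to normalization, a state for which `p` stays away from `M`.

Both parts are the case `S = T*` and the case `S = T` of the equivalence `tfae_of_le_adjoint`.
-/

namespace LocalGlobal

/-! ### Rotated graphs -/

/-- The rotation `(x, y) ↦ (-y, x)` of `V × V`, which carries the graph of `T*` into the
orthogonal complement of the graph of `T`. -/
def rotation (V : Type*) [AddCommGroup V] [Module ℂ V] : V × V →ₗ[ℂ] V × V :=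
  (-LinearMap.snd ℂ V V).prod (LinearMap.fst ℂ V V)

@[simp]
lemma rotation_apply {V : Type*} [AddCommGroup V] [Module ℂ V] (p : V × V) :
    rotation V p = (-p.2, p.1) := rfl

/-- The sum of `G` and the rotated `G'`. If `G` and `G'` are the graphs of `T` and of an operator
`S ⊆ T*`, the two summands are orthogonal. -/
def graphSum {V : Type*} [AddCommGroup V] [Module ℂ V] (G G' : Submodule ℂ (V × V)) :
    Submodule ℂ (V × V) :=
  G ⊔ G'.map (rotation V)

lemma mem_graphSum {V : Type*} [AddCommGroup V] [Module ℂ V] {G G' : Submodule ℂ (V × V)}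
    {p : V × V} : p ∈ graphSum G G' ↔ ∃ g ∈ G, ∃ s ∈ G', (g.1 - s.2, g.2 + s.1) = p := by
  simp [graphSum, Submodule.mem_sup, Prod.ext_iff, sub_eq_add_neg]

/-- A linear map applied to both components commutes with the formation of `graphSum`. -/
lemma map_graphSum {V W : Type*} [AddCommGroup V] [Module ℂ V] [AddCommGroup W] [Module ℂ W]
    (f : V →ₗ[ℂ] W) (G G' : Submodule ℂ (V × V)) :
    (graphSum G G').map (f.prodMap f)
      = graphSum (G.map (f.prodMap f)) (G'.map (f.prodMap f)) := by
  rw [graphSum, graphSum, Submodule.map_sup, ← Submodule.map_comp, ← Submodule.map_comp]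
  congr 2
  ext p <;> simp

lemma graphSum_mono {V : Type*} [AddCommGroup V] [Module ℂ V] {G₁ G₂ G₁' G₂' : Submodule ℂ (V × V)}
    (h : G₁ ≤ G₂) (h' : G₁' ≤ G₂') : graphSum G₁ G₁' ≤ graphSum G₂ G₂' :=
  sup_le_sup h (Submodule.map_mono h')

lemma graphSum_closure_le {V : Type*} [NormedAddCommGroup V] [NormedSpace ℂ V]
    (G G' : Submodule ℂ (V × V)) :
    graphSum G.topologicalClosure G'.topologicalClosure ≤ (graphSum G G').topologicalClosure := by
  refine sup_le (Submodule.topologicalClosure_mono le_sup_left) ?_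
  have hc : Continuous (rotation V) := (continuous_snd.neg.prodMk continuous_fst)
  rintro _ ⟨p, hp, rfl⟩
  refine closure_mono ?_ (image_closure_subset_closure_image hc ⟨p, hp, rfl⟩)
  rintro _ ⟨q, hq, rfl⟩
  exact (le_sup_right : _ ≤ graphSum G G') ⟨q, hq, rfl⟩

/-! ### Adjoints in Hilbert spaces -/

section HilbertSpace

variable {K : Type*} [NormedAddCommGroup K] [InnerProductSpace ℂ K]

lemma mem_adjoint_iff_inner {G : Submodule ℂ (K × K)} {p : K × K} :
    p ∈ G.adjoint ↔ ∀ g ∈ G, ⟪g.2, p.1⟫_ℂ = ⟪g.1, p.2⟫_ℂ := by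
  simp only [Submodule.mem_adjoint_iff, sub_eq_zero, Prod.forall]

/-- Pythagoras: `g ∈ G` is orthogonal to the rotated vector `(-p.2, p.1)`, so the distance between
the two is at least the length of `p`. -/
lemma norm_sq_add_le_of_mem_adjoint {G : Submodule ℂ (K × K)} {p g : K × K} (hp : p ∈ G.adjoint)
    (hg : g ∈ G) : ‖p.1‖ ^ 2 + ‖p.2‖ ^ 2 ≤ ‖p.2 + g.1‖ ^ 2 + ‖p.1 - g.2‖ ^ 2 := by
  have h := mem_adjoint_iff_inner.1 hp g hg
  rw [norm_add_sq (𝕜 := ℂ), norm_sub_sq (𝕜 := ℂ), ← inner_conj_symm p.2, ← inner_conj_symm p.1, h]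
  nlinarith [sq_nonneg ‖g.1‖, sq_nonneg ‖g.2‖]

/-- In a Hilbert space, `G'` is dense in the graph `G.adjoint` of the adjoint of `G` exactly when
`G` and the rotated `G'` together span a dense subspace. -/
lemma adjoint_le_closure_iff_dense [CompleteSpace K] {G G' : Submodule ℂ (K × K)}
    (hGG' : G' ≤ G.adjoint) :
    G.adjoint ≤ G'.topologicalClosure ↔ Dense (graphSum G G' : Set (K × K)) := by
  constructor
  · intro h
    -- A vector `r` orthogonal to the sum is a rotated element of `G.adjoint`, hence in the closure
    -- of the rotated `G'`, to which it is orthogonal as well.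
    let e := WithLp.prodContinuousLinearEquiv 2 ℂ K K
    let M : Submodule ℂ (WithLp 2 (K × K)) := (graphSum G G').comap e.toLinearMap
    have hM : Mᗮ = ⊥ := by
      rw [Submodule.eq_bot_iff]
      intro r hr
      rw [Submodule.mem_orthogonal] at hr
      have hr' : ∀ q ∈ graphSum G G', ⟪q.1, r.fst⟫_ℂ + ⟪q.2, r.snd⟫_ℂ = 0 := fun q hq =>
        hr (WithLp.toLp 2 q) hq
      have h1 : (r.snd, -r.fst) ∈ G.adjoint := mem_adjoint_iff_inner.2 fun g hg => by
        have := hr' g ((le_sup_left : _ ≤ graphSum G G') hg)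
        rw [inner_neg_right, eq_neg_iff_add_eq_zero, add_comm, this]
      have h2 : ∀ s ∈ G'.topologicalClosure, ⟪-s.2, r.fst⟫_ℂ + ⟪s.1, r.snd⟫_ℂ = 0 := by
        have hcl : IsClosed {s : K × K | ⟪-s.2, r.fst⟫_ℂ + ⟪s.1, r.snd⟫_ℂ = 0} :=
          isClosed_eq (by fun_prop) (by fun_prop)
        exact hcl.closure_subset_iff.2 fun s hs =>
          hr' _ ((le_sup_right : _ ≤ graphSum G G') ⟨s, hs, rfl⟩)
      have h3 := h2 _ (h h1)
      rw [← inner_self_eq_zero (𝕜 := ℂ), WithLp.prod_inner_apply]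
      simpa using h3
    have hd : Dense (M : Set (WithLp 2 (K × K))) := by
      rw [Submodule.dense_iff_topologicalClosure_eq_top,
        Submodule.topologicalClosure_eq_top_iff, hM]
    refine (e.surjective.denseRange.dense_image e.continuous hd).mono ?_
    rintro _ ⟨m, hm, rfl⟩
    exact hm
  · -- Approximate the rotated `p` by `g + s'` with `g ∈ G` and `s'` the rotated `s ∈ G'`; by
    -- Pythagoras `s` is already close to `p`.
    intro h p hp
    refine Metric.mem_closure_iff.2 fun ε hε => ?_
    obtain ⟨m, hm, hmp⟩ := h.exists_dist_lt (-p.2, p.1) (half_pos hε)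
    obtain ⟨g, hg, s, hs, rfl⟩ := mem_graphSum.1 hm
    refine ⟨s, hs, ?_⟩
    have h1 := norm_sq_add_le_of_mem_adjoint (sub_mem hp (hGG' hs)) hg
    have h2 : ‖(p - s).2 + g.1‖ < ε / 2 := by
      refine lt_of_eq_of_lt ?_ ((le_max_left _ _).trans_lt hmp)
      rw [dist_eq_norm, ← norm_neg]
      congr 1
      simp only [Prod.snd_sub]
      abel
    have h3 : ‖(p - s).1 - g.2‖ < ε / 2 := by
      refine lt_of_eq_of_lt ?_ ((le_max_right _ _).trans_lt hmp)
      rw [dist_eq_norm]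
      congr 1
      simp only [Prod.fst_sub]
      abel
    rw [dist_eq_norm, Prod.norm_def, max_lt_iff]
    constructor <;> refine lt_of_pow_lt_pow_left₀ 2 hε.le ?_ <;>
      nlinarith [sq_nonneg ‖(p - s).1‖, sq_nonneg ‖(p - s).2‖, norm_nonneg ((p - s).2 + g.1),
        norm_nonneg ((p - s).1 - g.2)]

/-- Let `R` and `R'` be the closed operators with cores `G` and `G'`. Then `R'` is the adjoint of
`R` exactly when `graphSum G G'` is dense. -/
lemma eq_adjoint_iff_dense [CompleteSpace K] {G G' : Submodule ℂ (K × K)} {R R' : K →ₗ.[ℂ] K}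
    (hR : R.graph = G.topologicalClosure) (hR' : R'.graph = G'.topologicalClosure)
    (hd : Dense (R.domain : Set K)) (hGG' : G' ≤ G.adjoint) :
    R' = R† ↔ Dense (graphSum G G' : Set (K × K)) := by
  have hcl : G.topologicalClosure.adjoint = G.adjoint := by
    refine le_antisymm (fun p hp => ?_) fun p hp => ?_
    · exact mem_adjoint_iff_inner.2 fun g hg =>
        mem_adjoint_iff_inner.1 hp g (G.le_topologicalClosure hg)
    · refine mem_adjoint_iff_inner.2 fun g hg => ?_
      have hc : IsClosed {g : K × K | ⟪g.2, p.1⟫_ℂ = ⟪g.1, p.2⟫_ℂ} :=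
        isClosed_eq (by fun_prop) (by fun_prop)
      exact hc.closure_subset_iff.2 (mem_adjoint_iff_inner.1 hp) hg
  have hle : G'.topologicalClosure ≤ G.adjoint := by
    intro p hp
    refine mem_adjoint_iff_inner.2 fun g hg => ?_
    have hc : IsClosed {p : K × K | ⟪g.2, p.1⟫_ℂ = ⟪g.1, p.2⟫_ℂ} :=
      isClosed_eq (by fun_prop) (by fun_prop)
    exact hc.closure_subset_iff.2 (fun p hp => mem_adjoint_iff_inner.1 (hGG' hp) g hg) hp
  have hadj : R†.graph = G.adjoint := by
    rw [LinearPMap.adjoint_graph_eq_graph_adjoint hd, hR, hcl]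
  rw [← adjoint_le_closure_iff_dense hGG', ← hadj, ← hR']
  constructor
  · rintro rfl
    exact le_rfl
  · exact fun h => LinearPMap.eq_of_eq_graph (le_antisymm (by rw [hR', hadj]; exact hle) h)

end HilbertSpace

/-! ### Hilbert modules -/

section Module

variable {A : Type u} [NonUnitalCStarAlgebra A] [PartialOrder A] [StarOrderedRing A]
variable {E : Type v} [NormedAddCommGroup E] [NormedSpace ℂ E] [SMul Aᵐᵒᵖ E] [CStarModule Aᵐᵒᵖ E]

variable (A) in
lemma eq_of_ip_eq {x y : E} (h : ∀ z, ip A z x = ip A z y) : x = y := by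
  rw [← sub_eq_zero]
  refine (ip_self_eq_zero A _).1 ?_
  have h1 : ip A (x - y) (x - y + y) = ip A (x - y) (x - y) + ip A (x - y) y :=
    ip_add_right A _ _ _
  rwa [sub_add_cancel, h, right_eq_add] at h1

lemma ip_neg_right (x y : E) : ip A x (-y) = -ip A x y := by
  simpa using ip_smul_right A (-1) x y

lemma ip_neg_left (x y : E) : ip A (-x) y = -ip A x y := by
  simpa using ip_smul_left A (-1) x y

lemma ip_sub_right (x y z : E) : ip A x (y - z) = ip A x y - ip A x z := by
  rw [sub_eq_add_neg, ip_add_right, ip_neg_right, sub_eq_add_neg]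

lemma ip_sub_left (x y z : E) : ip A (x - y) z = ip A x z - ip A y z := by
  rw [sub_eq_add_neg, ip_add_left, ip_neg_left, sub_eq_add_neg]

lemma op_smul_add_right (a : A) (x y : E) : op a • (x + y) = op a • x + op a • y :=
  eq_of_ip_eq A fun z => by simp only [ip_op_smul_right, ip_add_right, add_mul]

lemma op_smul_complex_smul (a : A) (c : ℂ) (x : E) : op a • (c • x) = c • (op a • x) :=
  eq_of_ip_eq A fun z => by simp only [ip_op_smul_right, ip_smul_right, smul_mul_assoc]

lemma op_add_smul_left (a b : A) (x : E) : op (a + b) • x = op a • x + op b • x :=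
  eq_of_ip_eq A fun z => by simp only [ip_op_smul_right, ip_add_right, mul_add]

lemma op_complex_smul_smul (a : A) (c : ℂ) (x : E) : op (c • a) • x = c • (op a • x) :=
  eq_of_ip_eq A fun z => by simp only [ip_op_smul_right, ip_smul_right, mul_smul_comm]

variable (A) in
/-- Vectors `x · a` approximate `x`, even if `A` has no unit. -/
lemma mem_closure_range_op_smul (x : E) : x ∈ closure (Set.range fun a : A => op a • x) := by
  have hl := CStarAlgebra.increasingApproximateUnit A
  set l := CStarAlgebra.approximateUnit A
  have h1 : Filter.Tendsto (fun a : A => ip A x x * a - ip A x x) l (nhds 0) := by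
    simpa using (hl.tendsto_mul_left (ip A x x)).sub_const (ip A x x)
  have hsq : Filter.Tendsto (fun a : A => ‖op a • x - x‖ ^ 2) l (nhds 0) := by
    refine squeeze_zero_norm' ?_ (by simpa using (h1.norm.const_mul 2))
    filter_upwards [hl.eventually_norm] with a ha
    have h2 : ip A (op a • x - x) (op a • x - x)
        = star a * (ip A x x * a - ip A x x) - (ip A x x * a - ip A x x) := by
      simp only [ip_sub_left, ip_sub_right, ip_op_smul_left, ip_op_smul_right, mul_sub, sub_mul,
        mul_assoc]
      abel
    rw [norm_pow, norm_norm, norm_sq_eq_norm_ip A, h2, two_mul]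
    refine (norm_sub_le _ _).trans (add_le_add_left ((norm_mul_le _ _).trans ?_) _)
    rw [norm_star]
    exact mul_le_of_le_one_left (norm_nonneg _) ha
  have hn : Filter.Tendsto (fun a : A => op a • x) l (nhds x) := by
    rw [tendsto_iff_norm_sub_tendsto_zero]
    have := hsq.sqrt
    simpa using this
  exact mem_closure_of_tendsto hn (Filter.Eventually.of_forall fun a => ⟨a, rfl⟩)

/-! ### Operators and their adjoints -/

variable (A) in
lemma mem_graph_adjoint_iff {T : E →ₗ.[ℂ] E} (hT : Dense (T.domain : Set E)) {q : E × E} :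
    q ∈ (adjoint A T).graph ↔ ∀ p ∈ T.graph, ip A p.2 q.1 = ip A p.1 q.2 := by
  rw [graph_adjoint A hT]
  constructor
  · rintro h ⟨x, y⟩ hp
    obtain ⟨z, rfl, rfl⟩ := (T.mem_graph_iff).1 hp
    exact h z
  · exact fun h x => h _ (T.mem_graph x)

/-- An operator `S ⊆ T*` intertwines the action of `A` as soon as its domain is a submodule and
`dom T` is dense. -/
lemma op_smul_mem_graph {T S : E →ₗ.[ℂ] E} (hT : Dense (T.domain : Set E))
    (hTS : ∀ p ∈ T.graph, ∀ q ∈ S.graph, ip A p.2 q.1 = ip A p.1 q.2)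
    (hS : ∀ (a : A) (x : E), x ∈ S.domain → op a • x ∈ S.domain) (a : A) {q : E × E}
    (hq : q ∈ S.graph) : (op a • q.1, op a • q.2) ∈ S.graph := by
  have hmem := S.mem_graph ⟨_, hS a _ (LinearPMap.mem_domain_of_mem_graph hq)⟩
  refine S.mem_graph_iff.2 ⟨⟨_, hS a _ (LinearPMap.mem_domain_of_mem_graph hq)⟩, rfl, ?_⟩
  rw [← sub_eq_zero]
  refine eq_zero_of_dense A hT fun x hx => ?_
  have h1 := hTS _ (T.mem_graph ⟨x, hx⟩) _ hmem
  have h2 := hTS _ (T.mem_graph ⟨x, hx⟩) _ hq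
  rw [ip_sub_right, sub_eq_zero, ← h1, ip_op_smul_right, ip_op_smul_right, ← h2]

/-- The adjoint of a semiregular operator is semiregular. -/
lemma isSemiregular_adjoint {T : E →ₗ.[ℂ] E} (hT : IsSemiregular A T) :
    IsSemiregular A (adjoint A T) where
  op_smul_mem a y hy := by
    have hq := (adjoint A T).mem_graph ⟨y, hy⟩
    rw [mem_graph_adjoint_iff A hT.dense_domain] at hq
    refine LinearPMap.mem_domain_of_mem_graph (y := op a • adjoint A T ⟨y, hy⟩) ?_
    refine (mem_graph_adjoint_iff A hT.dense_domain).2 fun p hp => ?_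
    simp only [ip_op_smul_right, hq p hp]
  dense_domain := hT.dense_adjoint_domain
  dense_adjoint_domain := by
    refine hT.dense_domain.mono fun x hx => ?_
    refine LinearPMap.mem_domain_of_mem_graph (y := T ⟨x, hx⟩) ?_
    refine (mem_graph_adjoint_iff A hT.dense_adjoint_domain).2 fun q hq => ?_
    have h := (mem_graph_adjoint_iff A hT.dense_domain).1 hq _ (T.mem_graph ⟨x, hx⟩)
    rw [← star_ip, ← h, star_ip]

/-- The adjoint of a densely defined operator is closed. -/
lemma isClosed_adjoint {T : E →ₗ.[ℂ] E} (hT : Dense (T.domain : Set E)) :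
    (adjoint A T).IsClosed := by
  have h : ((adjoint A T).graph : Set (E × E))
      = ⋂ p ∈ T.graph, {q | ip A p.2 q.1 = ip A p.1 q.2} := by
    ext q
    simpa using mem_graph_adjoint_iff A hT
  rw [LinearPMap.IsClosed, h]
  exact isClosed_biInter fun p _ => isClosed_eq
    ((continuous_ip_right A _).comp continuous_fst) ((continuous_ip_right A _).comp continuous_snd)

/-! ### The quadratic form of `E ⊕ E` -/

variable (A) in
/-- The `A`-valued square `⟨x, x⟩ + ⟨y, y⟩` of a vector `(x, y)` of the Hilbert module `E ⊕ E`. -/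
def pairSq (p : E × E) : A := ip A p.1 p.1 + ip A p.2 p.2

lemma pairSq_nonneg (p : E × E) : 0 ≤ pairSq A p :=
  add_nonneg (ip_self_nonneg A _) (ip_self_nonneg A _)

lemma norm_sq_le_norm_pairSq (p : E × E) : ‖p‖ ^ 2 ≤ ‖pairSq A p‖ := by
  have h1 : ‖p.1‖ ^ 2 ≤ ‖pairSq A p‖ := by
    rw [norm_sq_eq_norm_ip A]
    exact CStarAlgebra.norm_le_norm_of_nonneg_of_le (ip_self_nonneg A _)
      (le_add_of_nonneg_right (ip_self_nonneg A _))
  have h2 : ‖p.2‖ ^ 2 ≤ ‖pairSq A p‖ := by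
    rw [norm_sq_eq_norm_ip A]
    exact CStarAlgebra.norm_le_norm_of_nonneg_of_le (ip_self_nonneg A _)
      (le_add_of_nonneg_left (ip_self_nonneg A _))
  rw [Prod.norm_def]
  rcases max_choice ‖p.1‖ ‖p.2‖ with h | h <;> rw [h] <;> assumption

lemma norm_pairSq_le (p : E × E) : ‖pairSq A p‖ ≤ 2 * ‖p‖ ^ 2 := by
  refine (norm_add_le _ _).trans ?_
  rw [← norm_sq_eq_norm_ip, ← norm_sq_eq_norm_ip, two_mul]
  exact add_le_add (pow_le_pow_left₀ (norm_nonneg _) (norm_fst_le p) 2)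
    (pow_le_pow_left₀ (norm_nonneg _) (norm_snd_le p) 2)

/-- Pythagoras in `E ⊕ E`: the summands of `graphSum` are orthogonal. -/
lemma pairSq_add_rotation {g s : E × E} (h : ip A g.2 s.1 = ip A g.1 s.2) :
    pairSq A (g.1 - s.2, g.2 + s.1) = pairSq A g + pairSq A s := by
  have h' : ip A s.1 g.2 = ip A s.2 g.1 := by rw [← star_ip, h, star_ip]
  simp only [pairSq, ip_sub_left, ip_sub_right, ip_add_left, ip_add_right, h, h']
  abel

/-- For closed operators with `S ⊆ T*`, the orthogonal sum of the graphs is closed. -/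
lemma isClosed_graphSum [CompleteSpace E] {G G' : Submodule ℂ (E × E)}
    (hG : IsClosed (G : Set (E × E))) (hG' : IsClosed (G' : Set (E × E)))
    (h : ∀ p ∈ G, ∀ q ∈ G', ip A p.2 q.1 = ip A p.1 q.2) :
    IsClosed (graphSum G G' : Set (E × E)) := by
  have := hG.completeSpace_coe
  have := hG'.completeSpace_coe
  let f : G × G' →L[ℂ] E × E :=
    G.subtypeL.coprod (((-ContinuousLinearMap.snd ℂ E E).prod (ContinuousLinearMap.fst ℂ E E)).comp
      G'.subtypeL)
  have hf : ∀ p, f p = ((p.1 : E × E).1 - (p.2 : E × E).2, (p.1 : E × E).2 + (p.2 : E × E).1) := by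
    intro p
    simp [f, Prod.ext_iff, sub_eq_add_neg]
  have hr : (graphSum G G' : Set (E × E)) = Set.range f := by
    ext p
    simp [mem_graphSum, hf]
  rw [hr]
  refine AntilipschitzWith.isClosed_range (K := 2) ?_ f.uniformContinuous
  refine ContinuousLinearMap.antilipschitz_of_bound f fun p => ?_
  have h1 : ‖f p‖ ^ 2 * 2 ≥ ‖pairSq A (p.1 : E × E) + pairSq A (p.2 : E × E)‖ := by
    rw [mul_comm, ← pairSq_add_rotation (h _ p.1.2 _ p.2.2), ← hf]
    exact norm_pairSq_le _
  have h2 : ‖p.1‖ ^ 2 ≤ ‖f p‖ ^ 2 * 2 := by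
    refine (norm_sq_le_norm_pairSq (A := A) (p.1 : E × E)).trans (le_trans ?_ h1)
    exact CStarAlgebra.norm_le_norm_of_nonneg_of_le (pairSq_nonneg _)
      (le_add_of_nonneg_right (pairSq_nonneg _))
  have h3 : ‖p.2‖ ^ 2 ≤ ‖f p‖ ^ 2 * 2 := by
    refine (norm_sq_le_norm_pairSq (A := A) (p.2 : E × E)).trans (le_trans ?_ h1)
    exact CStarAlgebra.norm_le_norm_of_nonneg_of_le (pairSq_nonneg _)
      (le_add_of_nonneg_left (pairSq_nonneg _))
  have h0 := norm_nonneg (f p)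
  rw [Prod.norm_def, NNReal.coe_ofNat]
  refine max_le ?_ ?_ <;> refine le_of_sq_le_sq ?_ (by positivity) <;> nlinarith

/-! ### Regularity as a density statement -/

/-- If `T` is regular, then `E ⊕ E` is spanned, up to closure, by the graph of `T` and the rotated
graph of `T*`. -/
lemma dense_graphSum_of_isRegularOp {T : E →ₗ.[ℂ] E} (hT : IsRegularOp A T) :
    Dense (graphSum T.graph (adjoint A T).graph : Set (E × E)) := by
  set M := graphSum T.graph (adjoint A T).graph
  have h1 : ∀ x : E, (x, (0 : E)) ∈ M.topologicalClosure := by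
    have hc : Continuous fun x : E => (x, (0 : E)) := by fun_prop
    intro x
    refine closure_mono ?_ (image_closure_subset_closure_image hc ⟨x, hT.dense_range x, rfl⟩)
    -- `(x + T* T x, 0)` is the sum of `(x, T x)` and of the rotated `-(T x, T* T x)`.
    rintro _ ⟨_, ⟨x, y, w, hx, hy, rfl⟩, rfl⟩
    exact mem_graphSum.2 ⟨_, hx, _, neg_mem hy, by simp⟩
  have h2 : ∀ x : E, ((0 : E), x) ∈ M.topologicalClosure := by
    have hc : Continuous fun x : E => ((0 : E), x) := by fun_prop
    intro x
    refine closure_minimal ?_ isClosed_closure (image_closure_subset_closure_image hc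
      ⟨x, hT.isSemiregular.dense_adjoint_domain x, rfl⟩)
    -- `(0, y)` is the difference of the rotated `(y, T* y)` and of `(-T* y, 0)`.
    rintro _ ⟨y, hy, rfl⟩
    have h3 : (-(adjoint A T ⟨y, hy⟩), y) ∈ M :=
      mem_graphSum.2 ⟨0, zero_mem _, _, (adjoint A T).mem_graph ⟨y, hy⟩, by simp⟩
    change _ ∈ M.topologicalClosure
    have h4 := add_mem (M.le_topologicalClosure h3) (h1 (adjoint A T ⟨y, hy⟩))
    simpa using h4
  intro p
  change _ ∈ M.topologicalClosure
  have h5 := add_mem (h1 p.1) (h2 p.2)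
  simpa using h5

/-- If the graph of `T` and the rotated graph of a closed `S ⊆ T*` span a dense subspace of
`E ⊕ E`, then they span everything; hence `S = T*` and `I + T* T` is surjective. -/
lemma eq_adjoint_and_isRegularOp_of_dense [CompleteSpace E] {T S : E →ₗ.[ℂ] E} (hT : T.IsClosed)
    (hTr : IsSemiregular A T) (hS : S.IsClosed) (hST : S ≤ adjoint A T)
    (hd : Dense (graphSum T.graph S.graph : Set (E × E))) :
    S = adjoint A T ∧ IsRegularOp A T := by
  have hadj := fun q => mem_graph_adjoint_iff A hTr.dense_domain (q := q)
  have hTS : ∀ p ∈ T.graph, ∀ q ∈ S.graph, ip A p.2 q.1 = ip A p.1 q.2 := fun p hp q hq =>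
    (hadj q).1 (LinearPMap.le_graph_of_le hST hq) p hp
  have htop : ∀ p : E × E, p ∈ graphSum T.graph S.graph := by
    intro p
    have := (isClosed_graphSum hT hS hTS).closure_eq ▸ hd p
    exact this
  have heq : S = adjoint A T := by
    refine LinearPMap.eq_of_eq_graph (le_antisymm (LinearPMap.le_graph_of_le hST) fun q hq => ?_)
    obtain ⟨g, hg, s, hs, h⟩ := mem_graphSum.1 (htop (-q.2, q.1))
    -- `g` is the rotation of `q - s`, but it is also orthogonal to this rotation.
    have h1 := (hadj _).1 (sub_mem hq (LinearPMap.le_graph_of_le hST hs)) g hg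
    have hg1 : g.1 = -(q - s).2 := by
      have := congrArg Prod.fst h
      simp only [Prod.snd_sub] at this ⊢
      rw [← add_eq_of_eq_sub this.symm]
      abel
    have hg2 : g.2 = (q - s).1 := by
      have := congrArg Prod.snd h
      simp only [Prod.fst_sub] at this ⊢
      rw [← this]
      abel
    have h2 : pairSq A (q - s) = 0 := by
      rw [hg1, hg2, ip_neg_left] at h1
      rw [pairSq, h1, neg_add_cancel]
    have h3 : q - s = 0 := by
      have := norm_sq_le_norm_pairSq (A := A) (q - s)
      rw [h2, norm_zero] at this
      exact norm_eq_zero.1 (pow_eq_zero_iff two_ne_zero |>.1 (le_antisymm this (by positivity)))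
    rw [sub_eq_zero.1 h3]
    exact hs
  refine ⟨heq, hT, hTr, fun z => subset_closure ?_⟩
  obtain ⟨g, hg, s, hs, h⟩ := mem_graphSum.1 (htop (z, 0))
  rw [heq] at hs
  refine ⟨g.1, g.2, -s.2, hg, ?_, ?_⟩
  · have : g.2 = -s.1 := eq_neg_of_add_eq_zero_left (congrArg Prod.snd h)
    rw [this]
    exact neg_mem hs
  · rw [← sub_eq_add_neg]
    exact (congrArg Prod.fst h).symm

end Module

/-! ### Separation by states -/

section Separation

variable {A : Type u} [NonUnitalCStarAlgebra A] [PartialOrder A] [StarOrderedRing A]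
variable {E : Type v} [NormedAddCommGroup E] [NormedSpace ℂ E] [SMul Aᵐᵒᵖ E] [CStarModule Aᵐᵒᵖ E]

/-- A nonzero positive functional is a positive multiple of a state. -/
lemma exists_isState_smul (φ : A →ₚ[ℂ] ℂ) (hφ : ∃ a, φ a ≠ 0) :
    ∃ ω : A →ₚ[ℂ] ℂ, IsState ω ∧ ∃ c : ℝ, 0 < c ∧ ∀ a, φ a = c * ω a := by
  let f : A →L[ℂ] ℂ := ⟨(φ : A →ₗ[ℂ] ℂ), map_continuous φ⟩
  have hf : ∀ a, f a = φ a := fun _ => rfl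
  have hf0 : f ≠ 0 := by
    rintro h
    obtain ⟨a, ha⟩ := hφ
    exact ha (by rw [← hf, h]; rfl)
  have hc : 0 < ‖f‖ := norm_pos_iff.2 hf0
  let g : A →L[ℂ] ℂ := (((‖f‖⁻¹ : ℝ) : ℂ)) • f
  let ω : A →ₚ[ℂ] ℂ := PositiveLinearMap.mk₀ (g : A →ₗ[ℂ] ℂ) fun a ha => by
    have h1 : (0 : ℂ) ≤ ((‖f‖⁻¹ : ℝ) : ℂ) := Complex.zero_le_real.2 (inv_nonneg.2 hc.le)
    exact mul_nonneg h1 (φ.map_nonneg ha)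
  refine ⟨ω, ?_, ‖f‖, hc, fun a => ?_⟩
  · have : (⟨(ω : A →ₗ[ℂ] ℂ), map_continuous ω⟩ : A →L[ℂ] ℂ) = g := by ext; rfl
    rw [IsState, this, norm_smul, Complex.norm_real, norm_inv, norm_norm, inv_mul_cancel₀ hc.ne']
  · change f a = ‖f‖ * (((‖f‖⁻¹ : ℝ) : ℂ) * f a)
    rw [← mul_assoc, ← Complex.ofReal_mul, mul_inv_cancel₀ hc.ne', Complex.ofReal_one, one_mul]

/-- An upward closed convex set of positive elements that is bounded away from `0` in norm is
bounded away from `0` in a suitable state. -/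
lemma exists_isState_forall_le {C : Set A} (hC : Convex ℝ C) (hne : C.Nonempty)
    (h0 : ∀ a ∈ C, 0 ≤ a) (hup : ∀ a ∈ C, ∀ b, a ≤ b → b ∈ C) {r : ℝ} (hr : 0 < r)
    (hCr : ∀ a ∈ C, r ≤ ‖a‖) :
    ∃ ω : A →ₚ[ℂ] ℂ, IsState ω ∧ ∃ c : ℝ, 0 < c ∧ ∀ a ∈ C, c ≤ (ω a).re := by
  obtain ⟨f, s, hfs, hsf⟩ := RCLike.geometric_hahn_banach_open (𝕜 := ℂ) (convex_ball (0 : A) r)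
    Metric.isOpen_ball hC (Set.disjoint_left.2 fun a ha haC =>
      (hCr a haC).not_gt (mem_ball_zero_iff.1 ha))
  have hs : 0 < s := by simpa using hfs 0 (Metric.mem_ball_self hr)
  -- `C` is stable under adding positive elements, so `f` cannot be negative on them.
  have hpos : ∀ a : A, 0 ≤ a → 0 ≤ (f a).re := by
    intro a ha
    by_contra! hneg
    obtain ⟨b, hb⟩ := hne
    obtain ⟨n, hn⟩ := exists_nat_gt ((f b).re / -(f a).re)
    have h1 : b + (n : ℝ) • a ∈ C :=
      hup b hb _ (le_add_of_nonneg_right (smul_nonneg n.cast_nonneg ha))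
    have h2 := hsf _ h1
    rw [div_lt_iff₀ (by linarith)] at hn
    have h3 : f (b + (n : ℝ) • a) = f b + (n : ℂ) * f a := by
      rw [map_add, ← Complex.coe_smul, map_smul, smul_eq_mul, Complex.ofReal_natCast]
    rw [h3] at h2
    simp at h2
    linarith
  -- The hermitian part of `f`, a positive functional.
  let g : A →ₗ[ℂ] ℂ :=
    { toFun := fun a => (f a + star (f (star a))) / 2
      map_add' := fun a b => by simp only [star_add, map_add]; ring
      map_smul' := fun c a => by
        simp only [star_smul, map_smul, smul_eq_mul, star_mul', star_star, RingHom.id_apply]; ring }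
  have hg : ∀ a, 0 ≤ a → g a = (f a).re := by
    intro a ha
    change (f a + star (f (star a))) / 2 = _
    rw [(IsSelfAdjoint.of_nonneg ha).star_eq, Complex.star_def, Complex.add_conj]
    push_cast
    ring
  let φ : A →ₚ[ℂ] ℂ := PositiveLinearMap.mk₀ g fun a ha => by
    rw [hg a ha]
    exact Complex.zero_le_real.2 (hpos a ha)
  have hφ : ∀ a ∈ C, φ a = (f a).re := fun a ha => hg a (h0 a ha)
  obtain ⟨ω, hω, c, hc, hcω⟩ := exists_isState_smul φ (by
    obtain ⟨b, hb⟩ := hne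
    refine ⟨b, ?_⟩
    rw [hφ b hb]
    exact_mod_cast (hs.trans_le (hsf b hb)).ne')
  refine ⟨ω, hω, s / c, by positivity, fun a ha => ?_⟩
  have h1 := congrArg Complex.re (hcω a)
  rw [hφ a ha, Complex.re_ofReal_mul, Complex.ofReal_re] at h1
  rw [div_le_iff₀ hc, mul_comm, ← h1]
  exact hsf a ha

/-- The square is an operator convex function, by the parallelogram-type identity
`s q(p) + t q(p') - q(s p + t p') = s t q(p - p')` for `s + t = 1`. -/
lemma pairSq_convex_comb (p q : E × E) {s t : ℝ} (hs : 0 ≤ s) (ht : 0 ≤ t) (hst : s + t = 1) :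
    pairSq A ((s : ℂ) • p + (t : ℂ) • q) ≤ s • pairSq A p + t • pairSq A q := by
  have h : s • pairSq A p + t • pairSq A q - pairSq A ((s : ℂ) • p + (t : ℂ) • q)
      = (s * t) • pairSq A (p - q) := by
    obtain rfl : s = 1 - t := by linarith
    simp only [pairSq, Prod.fst_add, Prod.snd_add, Prod.smul_fst, Prod.smul_snd, Prod.fst_sub,
      Prod.snd_sub, ip_add_left, ip_add_right, ip_smul_left, ip_smul_right, ip_sub_left,
      ip_sub_right, Complex.star_def, Complex.conj_ofReal]
    simp only [Complex.coe_smul]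
    module
  rw [← sub_nonneg, h]
  exact smul_nonneg (mul_nonneg hs ht) (pairSq_nonneg _)

/-- The local-global principle for subspaces: a subspace of `E ⊕ E` is dense if its image in
`E^ω ⊕ E^ω` is dense for every state `ω`. -/
lemma dense_of_forall_isState (M : Submodule ℂ (E × E))
    (h : ∀ ω : A →ₚ[ℂ] ℂ, IsState ω →
      Dense (M.map ((stateMap ω).prodMap (stateMap ω)) : Set (StateSpace E ω × StateSpace E ω))) :
    Dense (M : Set (E × E)) := by
  intro p
  by_contra hp
  obtain ⟨δ, hδ, hball⟩ := Metric.isOpen_iff.1 isClosed_closure.isOpen_compl p hp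
  have hdist : ∀ m ∈ M, δ ≤ ‖p - m‖ := by
    intro m hm
    by_contra! hlt
    refine hball (Metric.mem_ball.2 ?_) (subset_closure hm)
    rwa [dist_comm, dist_eq_norm]
  obtain ⟨ω, hω, c, hc, hcω⟩ := exists_isState_forall_le
    (C := {a : A | ∃ m ∈ M, pairSq A (p - m) ≤ a}) (by
      rintro a ⟨m, hm, hma⟩ b ⟨n, hn, hnb⟩ s t hs ht hst
      refine ⟨(s : ℂ) • m + (t : ℂ) • n, add_mem (M.smul_mem _ hm) (M.smul_mem _ hn), ?_⟩
      have h1 : p - ((s : ℂ) • m + (t : ℂ) • n) = (s : ℂ) • (p - m) + (t : ℂ) • (p - n) := by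
        have h2 : p = ((s : ℂ) + (t : ℂ)) • p := by
          rw [← Complex.ofReal_add, hst, Complex.ofReal_one, one_smul]
        nth_rewrite 1 [h2]
        module
      rw [h1]
      exact (pairSq_convex_comb _ _ hs ht hst).trans
        (add_le_add (smul_le_smul_of_nonneg_left hma hs) (smul_le_smul_of_nonneg_left hnb ht)))
    ⟨_, 0, zero_mem _, le_rfl⟩ (fun a ⟨m, _, hma⟩ => (pairSq_nonneg _).trans hma)
    (fun a ⟨m, hm, hma⟩ b hab => ⟨m, hm, hma.trans hab⟩) (r := δ ^ 2) (by positivity)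
    (fun a ⟨m, hm, hma⟩ => (pow_le_pow_left₀ hδ.le (hdist m hm) 2).trans
      ((norm_sq_le_norm_pairSq _).trans
        (CStarAlgebra.norm_le_norm_of_nonneg_of_le (pairSq_nonneg _) hma)))
  obtain ⟨_, ⟨m, hm, rfl⟩, hlt⟩ := (h ω hω).exists_dist_lt
    (stateMap ω p.1, stateMap ω p.2) (ε := √(c / 2)) (by positivity)
  have hnorm : ∀ x : E, ‖stateMap ω x‖ ^ 2 = (ω (ip A x x)).re := fun x => by
    rw [← inner_stateMap, ← inner_self_eq_norm_sq (𝕜 := ℂ)]; rfl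
  have hsum : (ω (pairSq A (p - m))).re
      = ‖stateMap ω (p.1 - m.1)‖ ^ 2 + ‖stateMap ω (p.2 - m.2)‖ ^ 2 := by
    rw [hnorm, hnorm, pairSq, map_add, Complex.add_re]; rfl
  have hle := hcω _ ⟨m, hm, le_rfl⟩
  rw [hsum] at hle
  have hlt1 : ‖stateMap ω (p.1 - m.1)‖ < √(c / 2) := by
    rw [map_sub, ← dist_eq_norm]
    exact (le_max_left _ _).trans_lt hlt
  have hlt2 : ‖stateMap ω (p.2 - m.2)‖ < √(c / 2) := by
    rw [map_sub, ← dist_eq_norm]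
    exact (le_max_right _ _).trans_lt hlt
  rw [Real.lt_sqrt (norm_nonneg _)] at hlt1 hlt2
  linarith

end Separation

/-! ### Localizations of graphs -/

section Tensor

variable {A : Type u} [NonUnitalCStarAlgebra A] [PartialOrder A] [StarOrderedRing A]
variable {E : Type v} [NormedAddCommGroup E] [NormedSpace ℂ E] [SMul Aᵐᵒᵖ E] [CStarModule Aᵐᵒᵖ E]
variable {H : Type*} [NormedAddCommGroup H] [InnerProductSpace ℂ H] [CompleteSpace H]

lemma dense_span_tensorMap (π : A →⋆ₙₐ[ℂ] (H →L[ℂ] H)) {D : Set E} (hD : Dense D) :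
    Dense (Submodule.span ℂ {k | ∃ x ∈ D, ∃ h : H, k = tensorMap π (x ⊗ₜ h)} :
      Set (TensorSpace E π)) := by
  set V := Submodule.span ℂ {k | ∃ x ∈ D, ∃ h : H, k = tensorMap π (x ⊗ₜ h)}
  have h1 : ∀ t : E ⊗[ℂ] H, tensorMap π t ∈ V.topologicalClosure := by
    intro t
    induction t with
    | zero => simp
    | add s t hs ht => rw [map_add]; exact add_mem hs ht
    | tmul x h =>
      refine closure_mono ?_ (image_closure_subset_closure_image (continuous_tensorMap_left π h)
        ⟨x, hD x, rfl⟩)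
      rintro _ ⟨y, hy, rfl⟩
      exact Submodule.subset_span ⟨y, hy, h, rfl⟩
  rw [← dense_closure]
  exact (dense_range_tensorMap π).mono (by rintro _ ⟨t, rfl⟩; exact h1 t)

lemma dense_domain_localization (π : A →⋆ₙₐ[ℂ] (H →L[ℂ] H)) {T : E →ₗ.[ℂ] E}
    (hT : IsSemiregular A T) : Dense ((localization π T).domain : Set (TensorSpace E π)) := by
  refine (dense_span_tensorMap π hT.dense_domain).mono ?_
  refine Submodule.span_le.2 ?_
  rintro _ ⟨x, hx, h, rfl⟩
  refine LinearPMap.mem_domain_of_mem_graph (y := tensorMap π (T ⟨x, hx⟩ ⊗ₜ h)) ?_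
  rw [(localization_spec π hT).2.2]
  exact Submodule.le_topologicalClosure _ (Submodule.subset_span ⟨⟨x, hx⟩, h, rfl⟩)

lemma dense_domain_stateLocalization (ω : A →ₚ[ℂ] ℂ) {T : E →ₗ.[ℂ] E}
    (hT : IsSemiregular A T) : Dense ((stateLocalization ω T).domain : Set (StateSpace E ω)) := by
  have h1 : Dense (stateMap ω '' (T.domain : Set E)) :=
    DenseRange.dense_image (dense_range_stateMap ω) (continuous_stateMap ω) hT.dense_domain
  refine h1.mono ?_
  rintro _ ⟨x, hx, rfl⟩
  refine LinearPMap.mem_domain_of_mem_graph (y := stateMap ω (T ⟨x, hx⟩)) ?_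
  rw [(stateLocalization_spec ω hT).2.2]
  exact Submodule.le_topologicalClosure _ ⟨_, T.mem_graph ⟨x, hx⟩, rfl⟩

lemma tensorGraph_le_adjoint (π : A →⋆ₙₐ[ℂ] (H →L[ℂ] H)) {T S : E →ₗ.[ℂ] E}
    (hTS : ∀ p ∈ T.graph, ∀ q ∈ S.graph, ip A p.2 q.1 = ip A p.1 q.2) :
    tensorGraph π S ≤ (tensorGraph π T).adjoint := by
  refine Submodule.span_le.2 ?_
  rintro _ ⟨y, k, rfl⟩
  refine mem_adjoint_iff_inner.2 fun p hp => ?_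
  induction hp using Submodule.span_induction with
  | mem p hp =>
    obtain ⟨x, h, rfl⟩ := hp
    simp only [inner_tensorMap, tensorForm_tmul]
    rw [hTS _ (T.mem_graph x) _ (S.mem_graph y)]
  | zero => simp
  | add u v _ _ hu hv => simp only [Prod.fst_add, Prod.snd_add, inner_add_left, hu, hv]
  | smul c v _ hv => simp only [Prod.smul_fst, Prod.smul_snd, inner_smul_left, hv]

lemma stateGraph_le_adjoint (ω : A →ₚ[ℂ] ℂ) {T S : E →ₗ.[ℂ] E}
    (hTS : ∀ p ∈ T.graph, ∀ q ∈ S.graph, ip A p.2 q.1 = ip A p.1 q.2) :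
    stateGraph ω S ≤ (stateGraph ω T).adjoint := by
  rintro _ ⟨q, hq, rfl⟩
  refine mem_adjoint_iff_inner.2 ?_
  rintro _ ⟨p, hp, rfl⟩
  simp only [LinearMap.prodMap_apply, inner_stateMap]
  rw [hTS p hp q hq]

/-- Density of `graphSum` passes from the module to its localizations at representations. -/
lemma dense_graphSum_tensorGraph (π : A →⋆ₙₐ[ℂ] (H →L[ℂ] H)) {T S : E →ₗ.[ℂ] E}
    (hd : Dense (graphSum T.graph S.graph : Set (E × E))) :
    Dense (graphSum (tensorGraph π T) (tensorGraph π S) :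
      Set (TensorSpace E π × TensorSpace E π)) := by
  set N := graphSum (tensorGraph π T) (tensorGraph π S)
  have h1 : ∀ (p : E × E) (h : H),
      (tensorMap π (p.1 ⊗ₜ h), tensorMap π (p.2 ⊗ₜ h)) ∈ N.topologicalClosure := by
    intro p h
    let f : E →ₗ[ℂ] TensorSpace E π := tensorMap π ∘ₗ (TensorProduct.mk ℂ E H).flip h
    have hle : ∀ R : E →ₗ.[ℂ] E, R.graph.map (f.prodMap f) ≤ tensorGraph π R := by
      rintro R _ ⟨q, hq, rfl⟩
      obtain ⟨z, hz1, hz2⟩ := R.mem_graph_iff.1 hq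
      exact Submodule.subset_span ⟨z, h, by rw [hz1, hz2]; rfl⟩
    have hc : Continuous (f.prodMap f) :=
      ((continuous_tensorMap_left π h).comp continuous_fst).prodMk
        ((continuous_tensorMap_left π h).comp continuous_snd)
    refine closure_mono ?_ (image_closure_subset_closure_image hc ⟨p, hd p, rfl⟩)
    have := graphSum_mono (hle T) (hle S)
    rw [← map_graphSum] at this
    exact this
  have h2 : ∀ k : TensorSpace E π, (k, (0 : TensorSpace E π)) ∈ N.topologicalClosure := by
    intro k
    have hcl : IsClosed {k : TensorSpace E π | (k, (0 : TensorSpace E π)) ∈ N.topologicalClosure} :=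
      N.isClosed_topologicalClosure.preimage (by fun_prop)
    refine hcl.closure_subset_iff.2 ?_ (dense_range_tensorMap π k)
    rintro _ ⟨t, rfl⟩
    change _ ∈ N.topologicalClosure
    induction t with
    | zero => rw [map_zero]; exact zero_mem _
    | add s t hs ht => simpa using add_mem hs ht
    | tmul x h => simpa using h1 (x, 0) h
  have h3 : ∀ k : TensorSpace E π, ((0 : TensorSpace E π), k) ∈ N.topologicalClosure := by
    intro k
    have hcl : IsClosed
        {k : TensorSpace E π | ((0 : TensorSpace E π), k) ∈ N.topologicalClosure} :=
      N.isClosed_topologicalClosure.preimage (by fun_prop)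
    refine hcl.closure_subset_iff.2 ?_ (dense_range_tensorMap π k)
    rintro _ ⟨t, rfl⟩
    change _ ∈ N.topologicalClosure
    induction t with
    | zero => rw [map_zero]; exact zero_mem _
    | add s t hs ht => simpa using add_mem hs ht
    | tmul x h => simpa using h1 (0, x) h
  intro p
  change _ ∈ N.topologicalClosure
  simpa using add_mem (h2 p.1) (h3 p.2)

/-! ### From the GNS representation to the state -/

/-- The orbit map `[a] ↦ [x · a]` before completion. -/
def preOrbitMap (ω : A →ₚ[ℂ] ℂ) (x : E) : ω.PreGNS →ₗ[ℂ] PreState E ω where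
  toFun a := toPreState ω (op (ω.ofPreGNS a) • x)
  map_add' a b := by rw [map_add, op_add_smul_left, map_add]
  map_smul' c a := by
    rw [map_smul ω.ofPreGNS, op_complex_smul_smul, map_smul (toPreState ω)]; rfl

lemma inner_preOrbitMap (ω : A →ₚ[ℂ] ℂ) (x y : E) (a b : ω.PreGNS) :
    ⟪preOrbitMap ω x a, preOrbitMap ω y b⟫_ℂ
      = ω (star (ω.ofPreGNS a) * (ip A x y * ω.ofPreGNS b)) := by
  change ω (ip A (op (ω.ofPreGNS a) • x) (op (ω.ofPreGNS b) • y)) = _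
  rw [ip_op_smul_left, ip_op_smul_right]

lemma norm_preOrbitMap_le (ω : A →ₚ[ℂ] ℂ) (x : E) (a : ω.PreGNS) :
    ‖preOrbitMap ω x a‖ ≤ ‖x‖ * ‖a‖ := by
  refine le_of_sq_le_sq ?_ (by positivity)
  have h1 : star (ω.ofPreGNS a) * (ip A x x * ω.ofPreGNS a)
      ≤ ‖ip A x x‖ • (star (ω.ofPreGNS a) * ω.ofPreGNS a) := by
    rw [← mul_assoc]
    exact CStarAlgebra.star_left_conjugate_le_norm_smul
      (hb := IsSelfAdjoint.of_nonneg (ip_self_nonneg A x))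
  have h2 := (Complex.le_def.1 (OrderHomClass.mono ω h1)).1
  rw [← inner_self_eq_norm_sq (𝕜 := ℂ), inner_preOrbitMap, mul_pow, norm_sq_eq_norm_ip A,
    ← inner_self_eq_norm_sq (𝕜 := ℂ) a, PositiveLinearMap.preGNS_inner_def]
  refine h2.trans_eq ?_
  rw [← Complex.coe_smul, map_smul, smul_eq_mul, Complex.re_ofReal_mul]
  rfl

/-- The orbit map `[a] ↦ ι_ω (x · a)` from the GNS space of `ω` to `E^ω`. -/
noncomputable def orbitMap (ω : A →ₚ[ℂ] ℂ) (x : E) : ω.GNS →L[ℂ] StateSpace E ω :=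
  ((preOrbitMap ω x).mkContinuous ‖x‖ (norm_preOrbitMap_le ω x)).completion

lemma orbitMap_coe (ω : A →ₚ[ℂ] ℂ) (x : E) (a : ω.PreGNS) :
    orbitMap ω x a = (preOrbitMap ω x a : StateSpace E ω) := by
  simp [orbitMap]

lemma orbitMap_toPreGNS (ω : A →ₚ[ℂ] ℂ) (x : E) (a : A) :
    orbitMap ω x (ω.toPreGNS a : ω.PreGNS) = stateMap ω (op a • x) :=
  orbitMap_coe ω x _

lemma orbitMap_add (ω : A →ₚ[ℂ] ℂ) (x y : E) :
    orbitMap ω (x + y) = orbitMap ω x + orbitMap ω y := by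
  ext h
  induction h using Completion.induction_on with
  | hp => apply isClosed_eq <;> fun_prop
  | ih a =>
    obtain ⟨a, rfl⟩ := ω.toPreGNS.surjective a
    rw [add_apply, orbitMap_toPreGNS, orbitMap_toPreGNS, orbitMap_toPreGNS, op_smul_add_right,
      map_add]

lemma orbitMap_smul (ω : A →ₚ[ℂ] ℂ) (c : ℂ) (x : E) :
    orbitMap ω (c • x) = c • orbitMap ω x := by
  ext h
  induction h using Completion.induction_on with
  | hp => exact isClosed_eq (orbitMap ω (c • x)).continuous (c • orbitMap ω x).continuous
  | ih a =>
    obtain ⟨a, rfl⟩ := ω.toPreGNS.surjective a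
    rw [smul_apply, orbitMap_toPreGNS, orbitMap_toPreGNS, op_smul_complex_smul, map_smul]

/-- The identity `⟨x · a, y · b⟩ = a* ⟨x, y⟩ b`, read in the GNS space. -/
lemma inner_orbitMap (ω : A →ₚ[ℂ] ℂ) (x y : E) (h k : ω.GNS) :
    ⟪orbitMap ω x h, orbitMap ω y k⟫_ℂ = ⟪h, ω.gnsNonUnitalStarAlgHom (ip A x y) k⟫_ℂ := by
  induction h, k using Completion.induction_on₂ with
  | hp => apply isClosed_eq <;> fun_prop
  | ih a b =>
    rw [orbitMap_coe, orbitMap_coe, Completion.inner_coe, inner_preOrbitMap,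
      PositiveLinearMap.gnsNonUnitalStarAlgHom_apply_coe, Completion.inner_coe,
      PositiveLinearMap.preGNS_inner_def]
    rfl

/-- The GNS representation of `ω`, carried over to an isometric copy `H` of the GNS space. -/
noncomputable def gnsRep (ω : A →ₚ[ℂ] ℂ) (e : H ≃ₗᵢ[ℂ] ω.GNS) : A →⋆ₙₐ[ℂ] (H →L[ℂ] H) :=
  e.symm.conjStarAlgEquiv.toNonUnitalStarAlgHom.comp ω.gnsNonUnitalStarAlgHom

variable (E) in
/-- The map `x ⊗ h ↦ x · h` from `E ⊗ H` to `E^ω`, where `x · [a] = ι_ω (x · a)`. -/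
noncomputable def tensorToState₀ (ω : A →ₚ[ℂ] ℂ) (e : H ≃ₗᵢ[ℂ] ω.GNS) :
    E ⊗[ℂ] H →ₗ[ℂ] StateSpace E ω :=
  TensorProduct.lift <| LinearMap.mk₂ ℂ (fun x h => orbitMap ω x (e h))
    (fun x y h => by rw [orbitMap_add, add_apply])
    (fun c x h => by rw [orbitMap_smul, smul_apply])
    (fun x h k => by rw [map_add, map_add])
    (fun c x h => by rw [map_smul, map_smul])

set_option linter.unusedSectionVars false in
lemma tensorToState₀_tmul (ω : A →ₚ[ℂ] ℂ) (e : H ≃ₗᵢ[ℂ] ω.GNS) (x : E) (h : H) :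
    tensorToState₀ E ω e (x ⊗ₜ h) = orbitMap ω x (e h) := by
  simp [tensorToState₀]

lemma inner_tensorToState₀ (ω : A →ₚ[ℂ] ℂ) (e : H ≃ₗᵢ[ℂ] ω.GNS) (s t : E ⊗[ℂ] H) :
    ⟪tensorToState₀ E ω e s, tensorToState₀ E ω e t⟫_ℂ = tensorForm E (gnsRep ω e) s t := by
  induction s with
  | zero => simp
  | add s₁ s₂ h₁ h₂ => simp [inner_add_left, h₁, h₂]
  | tmul x h =>
    induction t with
    | zero => simp
    | add t₁ t₂ h₁ h₂ => simp [inner_add_right, h₁, h₂]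
    | tmul y k =>
      rw [tensorToState₀_tmul, tensorToState₀_tmul, inner_orbitMap, tensorForm_tmul,
        ← e.inner_map_map h]
      congr 1
      exact (e.apply_symm_apply _).symm

lemma norm_tensorToState₀ (ω : A →ₚ[ℂ] ℂ) (e : H ≃ₗᵢ[ℂ] ω.GNS) (t : E ⊗[ℂ] H) :
    ‖tensorToState₀ E ω e t‖ = ‖tensorMap (gnsRep ω e) t‖ := by
  rw [norm_eq_sqrt_re_inner (𝕜 := ℂ), norm_eq_sqrt_re_inner (𝕜 := ℂ), inner_tensorToState₀,
    inner_tensorMap]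

variable (E) in
/-- The natural isometry from the interior tensor product with the GNS space to `E^ω`. -/
noncomputable def tensorToState (ω : A →ₚ[ℂ] ℂ) (e : H ≃ₗᵢ[ℂ] ω.GNS) :
    TensorSpace E (gnsRep ω e) →L[ℂ] StateSpace E ω :=
  (tensorToState₀ E ω e).extendOfNorm (tensorMap (gnsRep ω e))

lemma tensorToState_tensorMap (ω : A →ₚ[ℂ] ℂ) (e : H ≃ₗᵢ[ℂ] ω.GNS) (t : E ⊗[ℂ] H) :
    tensorToState E ω e (tensorMap (gnsRep ω e) t) = tensorToState₀ E ω e t :=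
  LinearMap.extendOfNorm_eq (dense_range_tensorMap _)
    ⟨1, fun t => by rw [norm_tensorToState₀, one_mul]⟩ t

lemma denseRange_tensorToState (ω : A →ₚ[ℂ] ℂ) (e : H ≃ₗᵢ[ℂ] ω.GNS) :
    DenseRange (tensorToState E ω e) := by
  refine (dense_range_stateMap ω).closure.mono ?_ |>.of_closure
  refine closure_minimal ?_ isClosed_closure
  rintro _ ⟨x, rfl⟩
  refine closure_mono ?_ (image_closure_subset_closure_image (continuous_stateMap ω)
    ⟨x, mem_closure_range_op_smul A x, rfl⟩)
  rintro _ ⟨_, ⟨a, rfl⟩, rfl⟩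
  refine ⟨tensorMap (gnsRep ω e) (x ⊗ₜ e.symm (ω.toPreGNS a : ω.PreGNS)), ?_⟩
  rw [tensorToState_tensorMap, tensorToState₀_tmul, e.apply_symm_apply, orbitMap_toPreGNS]

/-- The isometry from the tensor product maps `T₀^π` into the closure of `T₀^ω`, if the graph of
`T` is stable under the action of `A`. -/
lemma map_tensorGraph_le (ω : A →ₚ[ℂ] ℂ) (e : H ≃ₗᵢ[ℂ] ω.GNS) {T : E →ₗ.[ℂ] E}
    (hT : ∀ (a : A), ∀ q ∈ T.graph, (op a • q.1, op a • q.2) ∈ T.graph) :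
    (tensorGraph (gnsRep ω e) T).map
        ((tensorToState E ω e).toLinearMap.prodMap (tensorToState E ω e).toLinearMap)
      ≤ (stateGraph ω T).topologicalClosure := by
  rw [tensorGraph, Submodule.map_span_le]
  rintro _ ⟨x, h, rfl⟩
  change (tensorToState E ω e (tensorMap (gnsRep ω e) ((x : E) ⊗ₜ[ℂ] h)),
    tensorToState E ω e (tensorMap (gnsRep ω e) (T x ⊗ₜ[ℂ] h))) ∈ _
  simp only [tensorToState_tensorMap, tensorToState₀_tmul]
  generalize e h = k
  induction k using Completion.induction_on with
  | hp => exact (stateGraph ω T).isClosed_topologicalClosure.preimage (by fun_prop)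
  | ih a =>
    obtain ⟨a, rfl⟩ := ω.toPreGNS.surjective a
    rw [orbitMap_toPreGNS, orbitMap_toPreGNS]
    exact Submodule.le_topologicalClosure _ ⟨_, hT a _ (T.mem_graph x), rfl⟩

/-- Density of `graphSum` passes from the localization at the GNS representation of `ω` to the
localization at `ω`. -/
lemma dense_graphSum_stateGraph (ω : A →ₚ[ℂ] ℂ) (e : H ≃ₗᵢ[ℂ] ω.GNS) {T S : E →ₗ.[ℂ] E}
    (hT : ∀ (a : A), ∀ q ∈ T.graph, (op a • q.1, op a • q.2) ∈ T.graph)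
    (hS : ∀ (a : A), ∀ q ∈ S.graph, (op a • q.1, op a • q.2) ∈ S.graph)
    (hd : Dense (graphSum (tensorGraph (gnsRep ω e) T) (tensorGraph (gnsRep ω e) S) :
      Set (TensorSpace E (gnsRep ω e) × TensorSpace E (gnsRep ω e)))) :
    Dense (graphSum (stateGraph ω T) (stateGraph ω S) :
      Set (StateSpace E ω × StateSpace E ω)) := by
  let U := tensorToState E ω e
  have hU : DenseRange (Prod.map U U) :=
    (denseRange_tensorToState ω e).prodMap (denseRange_tensorToState ω e)
  have h1 := hU.dense_image (by fun_prop) hd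
  have h2 := (graphSum_mono (map_tensorGraph_le ω e hT) (map_tensorGraph_le ω e hS)).trans
    (graphSum_closure_le _ _)
  rw [← map_graphSum] at h2
  rw [← dense_closure]
  exact h1.mono h2

end Tensor

/-! ### The equivalence for a pair of formally adjoint operators -/

/-- The inner product on a copy of a Hilbert space in a larger universe. -/
noncomputable abbrev uliftInnerProductSpace (H : Type u) [NormedAddCommGroup H]
    [InnerProductSpace ℂ H] : InnerProductSpace ℂ (ULift.{w} H) where
  inner x y := ⟪x.down, y.down⟫_ℂ
  norm_sq_eq_re_inner x := norm_sq_eq_re_inner (𝕜 := ℂ) x.down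
  conj_inner_symm x y := inner_conj_symm x.down y.down
  add_left x y z := inner_add_left x.down y.down z.down
  smul_left x y c := inner_smul_left x.down y.down c

section Main

variable {A : Type u} [NonUnitalCStarAlgebra A] [PartialOrder A] [StarOrderedRing A]
  {E : Type v} [NormedAddCommGroup E] [NormedSpace ℂ E] [CompleteSpace E]
  [SMul Aᵐᵒᵖ E] [CStarModule Aᵐᵒᵖ E]

/-- Let `T` and `S ⊆ T*` be closed and semiregular. Then `T` is regular with `S = T*` if and only
if `S^π` is the adjoint of `T^π` for all representations, or `S^ω` that of `T^ω` for all states. -/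
theorem tfae_of_le_adjoint {T S : E →ₗ.[ℂ] E} (hT : T.IsClosed) (hTr : IsSemiregular A T)
    (hS : S.IsClosed) (hSr : IsSemiregular A S) (hST : S ≤ adjoint A T) :
    List.TFAE
      [S = adjoint A T ∧ IsRegularOp A T,
        ∀ (H : Type (max u w)) [NormedAddCommGroup H] [InnerProductSpace ℂ H] [CompleteSpace H]
          (π : A →⋆ₙₐ[ℂ] (H →L[ℂ] H)), localization π S = (localization π T)†,
        ∀ ω : A →ₚ[ℂ] ℂ, IsState ω → stateLocalization ω S = (stateLocalization ω T)†] := by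
  have hTS : ∀ p ∈ T.graph, ∀ q ∈ S.graph, ip A p.2 q.1 = ip A p.1 q.2 := fun p hp q hq =>
    (mem_graph_adjoint_iff A hTr.dense_domain).1 (LinearPMap.le_graph_of_le hST hq) p hp
  have hST' : ∀ p ∈ S.graph, ∀ q ∈ T.graph, ip A p.2 q.1 = ip A p.1 q.2 := fun p hp q hq => by
    rw [← star_ip, ← hTS q hq p hp, star_ip]
  have hTA := fun (a : A) q hq =>
    op_smul_mem_graph (q := q) hSr.dense_domain hST' hTr.op_smul_mem a hq
  have hSA := fun (a : A) q hq =>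
    op_smul_mem_graph (q := q) hTr.dense_domain hTS hSr.op_smul_mem a hq
  have hπ := fun (H : Type (max u w)) [NormedAddCommGroup H] [InnerProductSpace ℂ H]
      [CompleteSpace H] (π : A →⋆ₙₐ[ℂ] (H →L[ℂ] H)) =>
    eq_adjoint_iff_dense (localization_spec π hTr).2.2 (localization_spec π hSr).2.2
      (dense_domain_localization π hTr) (tensorGraph_le_adjoint π hTS)
  have hω := fun ω : A →ₚ[ℂ] ℂ =>
    eq_adjoint_iff_dense (stateLocalization_spec ω hTr).2.2 (stateLocalization_spec ω hSr).2.2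
      (dense_domain_stateLocalization ω hTr) (stateGraph_le_adjoint ω hTS)
  simp only [hπ, hω]
  tfae_have 1 → 2
  | ⟨h, hreg⟩, H, _, _, _, π => by
    subst h
    exact dense_graphSum_tensorGraph π (dense_graphSum_of_isRegularOp hreg)
  tfae_have 2 → 3
  | h, ω, _ => by
    -- The GNS space lives in the universe of `A`, so a copy in the larger universe is used.
    let _ := uliftInnerProductSpace.{u, w} ω.GNS
    exact dense_graphSum_stateGraph ω
      (LinearIsometryEquiv.ulift ℂ ω.GNS : ULift.{w} ω.GNS ≃ₗᵢ[ℂ] ω.GNS) hTA hSA (h _ _)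
  tfae_have 3 → 1 := fun h =>
    eq_adjoint_and_isRegularOp_of_dense hT hTr hS hST <| dense_of_forall_isState _ fun ω hω => by
      rw [map_graphSum]
      exact h ω hω
  tfae_finish

end Main

end LocalGlobal

open LocalGlobal in
theorem theorem4p2 {A : Type u} [NonUnitalCStarAlgebra A] [PartialOrder A] [StarOrderedRing A]
    {E : Type v} [NormedAddCommGroup E] [NormedSpace ℂ E] [CompleteSpace E]
    [SMul Aᵐᵒᵖ E] [CStarModule Aᵐᵒᵖ E] (T : E →ₗ.[ℂ] E) (hT : T.IsClosed) :
    (IsSemiregular A T →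
      List.TFAE
        [IsRegularOp A T,
          ∀ (H : Type (max u w)) [NormedAddCommGroup H] [InnerProductSpace ℂ H] [CompleteSpace H]
            (π : A →⋆ₙₐ[ℂ] (H →L[ℂ] H)), localization π (adjoint A T) = (localization π T)†,
          ∀ ω : A →ₚ[ℂ] ℂ, IsState ω →
            stateLocalization ω (adjoint A T) = (stateLocalization ω T)†]) ∧
    (IsDenselyDefined A T → IsSymmetric A T →
      List.TFAE
        [IsSelfadjoint A T ∧ IsRegularOp A T,
          ∀ (H : Type (max u w)) [NormedAddCommGroup H] [InnerProductSpace ℂ H] [CompleteSpace H]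
            (π : A →⋆ₙₐ[ℂ] (H →L[ℂ] H)), localization π T = (localization π T)†,
          ∀ ω : A →ₚ[ℂ] ℂ, IsState ω →
            stateLocalization ω T = (stateLocalization ω T)†]) := by
  refine ⟨fun hTr => ?_, fun hTd hsym => ?_⟩
  · simpa only [true_and] using tfae_of_le_adjoint.{u, v, w} hT hTr
      (isClosed_adjoint hTr.dense_domain) (isSemiregular_adjoint hTr) le_rfl
  · have hTr : IsSemiregular A T := ⟨hTd, hTd.dense_domain.mono hsym.1⟩
    exact tfae_of_le_adjoint.{u, v, w} hT hTr hT hTr hsym
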